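/- Let $K$ be a field of characteristic $0$ and $V$ a $K$-vector space with a braiding $\sigma$, i.e. an invertible $\sigma\in\mathrm{End}(V\otimes V)$ with $(\sigma\otimes\mathrm{id})(\mathrm{id}\otimes\sigma)(\sigma\otimes\mathrm{id})=(\mathrm{id}\otimes\sigma)(\sigma\otimes\mathrm{id})(\mathrm{id}\otimes\sigma)$. On $V^{\otimes n}$ put $\sigma_i=\mathrm{id}_V^{\otimes(i-1)}\otimes\sigma\otimes\mathrm{id}_V^{\otimes(n-i-1)}$, and for $w\in\mathfrak S_n$ let $T^\sigma_w=\sigma_{i_1}\cdots\sigma_{i_l}$, where $w=s_{i_1}\cdots s_{i_l}$ is a reduced expression in the transpositions $s_i=(i,i+1)$. Let $T(V)=\bigoplus_{n\ge0}V^{\otimes n}$ with its usual grading, let $\varepsilon$ be the projection onto $V^{\otimes 0}=K$, and let $\delta$ be the deconcatenation $\delta(v_1\otimes\cdots\otimes v_n)=\sum_{i=0}^n(v_1\otimes\cdots\otimes v_i)\,\underline\otimes\,(v_{i+1}\otimes\cdots\otimes v_n)$, where $\underline\otimes$ is the tensor product between copies of $T(V)$. Let $\beta$ be the endomorphism of $T(V)\underline\otimes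 T(V)$ which on $V^{\otimes i}\underline\otimes V^{\otimes j}$ is $\beta_{ij}=T^\sigma_{\chi_{ij}}$, with values in $V^{\otimes j}\underline\otimes V^{\otimes i}$, where $\chi_{ij}\in\mathfrak S_{i+j}$ sends $k$ to $k+j$ for $k\le i$ and to $k-i$ for $k>i$ (so $\beta_{0i}$, $\beta_{i0}$ are the flips). Put $\Delta_\beta=(\mathrm{id}\otimes\beta\otimes\mathrm{id})\circ(\delta\otimes\delta)$ and, on $C=T(V)\underline\otimes T(V)$ with $1_C=1\underline\otimes1$, $$\overline{\Delta}_\beta(x)=\Delta_\beta(x)-x\otimes1_C-1_C\otimes x,\qquad \overline{\Delta}_\beta^{(0)}=\mathrm{id},\qquad \overline{\Delta}_\beta^{(n)}=(\overline{\Delta}_\beta\otimes\mathrm{id}_C^{\otimes(n-1)})\circ\overline{\Delta}_\beta^{(n-1)}\quad(n\ge1).$$ Let $(V,M,\sigma)$ be a quantum $\mathbf B_\infty$-algebra: $M=\bigoplus_{p,q\ge0}M_{pq}$ with linear maps $M_{pq}:V^{\otimes p}\underline\otimes V^{\otimes q}\to V$ such that 1. $M_{00}=0$, $M_{10}=\mathrm{id}_V=M_{01}$,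 and $M_{n0}=0=M_{0n}$ for $n\ge2$; 2. for all $i,j,k\ge1$: $\beta_{1k}(M_{ij}\otimes\mathrm{id}_V^{\otimes k})=(\mathrm{id}_V^{\otimes k}\otimes M_{ij})\beta_{i+j,k}$ and $\beta_{i1}(\mathrm{id}_V^{\otimes i}\otimes M_{jk})=(M_{jk}\otimes\mathrm{id}_V^{\otimes i})\beta_{i,j+k}$; 3. for all $i,j,k\ge1$, on $V^{\otimes i}\underline\otimes V^{\otimes j}\underline\otimes V^{\otimes k}$: $\sum_{r=1}^{i+j}M_{rk}\circ\big((M^{\otimes r}\circ\overline{\Delta}_\beta^{(r-1)})\otimes\mathrm{id}_V^{\otimes k}\big)=\sum_{l=1}^{j+k}M_{il}\circ\big(\mathrm{id}_V^{\otimes i}\otimes(M^{\otimes l}\circ\overline{\Delta}_\beta^{(l-1)})\big)$. Let $\ast=\varepsilon\otimes\varepsilon+\sum_{n\ge1}M^{\otimes n}\circ\overline{\Delta}_\beta^{(n-1)}:T(V)\underline\otimes T(V)\to T(V)$ (a finite sum on each element). Let $\mathfrak S_{i,j}\subset\mathfrak S_{i+j}$ be the set of $(i,j)$-shuffles, i.e.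 the $w$ with $w(1)<\cdots<w(i)$ and $w(i+1)<\cdots<w(i+j)$, and let $\mathrm{sh}_\sigma$ be the quantum shuffle product on $T(V)$, given by $x\,\mathrm{sh}_\sigma\,y=\sum_{w\in\mathfrak S_{i,j}}T^\sigma_w(x\otimes y)$ for $x\in V^{\otimes i}$, $y\in V^{\otimes j}$. Then the term of highest degree in the product $\ast$ is the quantum shuffle product: for all $i,j\ge0$, $x\in V^{\otimes i}$, $y\in V^{\otimes j}$, the components of $x\ast y$ in $V^{\otimes n}$ vanish for $n>i+j$, and its component in $V^{\otimes(i+j)}$ is $x\,\mathrm{sh}_\sigma\,y$. Moreover, for all $i,j\ge0$ with $i+j\ge1$ (in particular for all $i,j\ge1$), $$M^{\otimes(i+j)}\circ\overline{\Delta}_\beta^{(i+j-1)}=\sum_{w\in\mathfrak S_{i,j}}T^\sigma_w\qquad\text{on }V^{\otimes i}\underline\otimes V^{\otimes j}.$$ -/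

import Mathlib

open scoped TensorProduct DirectSum

noncomputable section

namespace QuantumBInfty

/-! ### Reduced expressions in the symmetric group -/

/-- The simple transposition exchanging the (0-based) letters `i` and `i + 1` of `Fin n`. -/
def simpleSwap (n : ℕ) (i : Fin (n - 1)) : Equiv.Perm (Fin n) :=
  Equiv.swap ⟨i, by omega⟩ ⟨i + 1, by omega⟩

/-- `l` is a reduced expression of `w`: the product of the corresponding simple transpositions is
`w`, and no shorter word has this property. -/
def IsReducedWord {n : ℕ} (w : Equiv.Perm (Fin n)) (l : List (Fin (n - 1))) : Prop :=
  (l.map (simpleSwap n)).prod = w ∧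
    ∀ l' : List (Fin (n - 1)), (l'.map (simpleSwap n)).prod = w → l.length ≤ l'.length

theorem exists_word {n : ℕ} (w : Equiv.Perm (Fin n)) :
    ∃ l : List (Fin (n - 1)), (l.map (simpleSwap n)).prod = w := by
  cases n with
  | zero => exact ⟨[], Subsingleton.elim _ _⟩
  | succ n =>
    have hw : w ∈ Submonoid.closure (Set.range (simpleSwap (n + 1))) := by
      have h := Equiv.Perm.mclosure_swap_castSucc_succ n
      have h2 : (Set.range fun i : Fin n ↦ Equiv.swap i.castSucc i.succ)
          = Set.range (simpleSwap (n + 1)) := rfl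
      rw [← h2, h]
      trivial
    obtain ⟨l, hl, hp⟩ := Submonoid.exists_list_of_mem_closure hw
    have : ∀ l : List (Equiv.Perm (Fin (n + 1))),
        (∀ y ∈ l, y ∈ Set.range (simpleSwap (n + 1))) →
        ∃ l' : List (Fin (n + 1 - 1)), l'.map (simpleSwap (n + 1)) = l := by
      intro l
      induction l with
      | nil => exact fun _ => ⟨[], rfl⟩
      | cons a l ih =>
        intro h
        obtain ⟨l', hl'⟩ := ih fun y hy => h y (List.mem_cons_of_mem _ hy)
        obtain ⟨i, hi⟩ := h a List.mem_cons_self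
        exact ⟨i :: l', by simp [hi, hl']⟩
    obtain ⟨l', hl'⟩ := this l hl
    exact ⟨l', by rw [hl', hp]⟩

theorem exists_reducedWord {n : ℕ} (w : Equiv.Perm (Fin n)) :
    ∃ l : List (Fin (n - 1)), IsReducedWord w l := by
  classical
  have h : ∃ k, ∃ l : List (Fin (n - 1)), (l.map (simpleSwap n)).prod = w ∧ l.length = k := by
    obtain ⟨l, hl⟩ := exists_word w
    exact ⟨l.length, l, hl, rfl⟩
  obtain ⟨l, hl, hk⟩ := Nat.find_spec h
  refine ⟨l, hl, fun l' hl' => ?_⟩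
  rw [hk]
  exact Nat.find_min' h ⟨l', hl', rfl⟩

/-- A reduced expression of `w`. -/
def reducedWord {n : ℕ} (w : Equiv.Perm (Fin n)) : List (Fin (n - 1)) :=
  (exists_reducedWord w).choose

/-- The permutation `χ_{ij}`, sending `k` to `k + j` if `k < i` and to `k - i` otherwise. -/
def chi (i j : ℕ) : Equiv.Perm (Fin (i + j)) :=
  finAddFlip.trans (finCongr (Nat.add_comm j i))

/-- The set `𝔖_{i,j}` of `(i, j)`-shuffles: the permutations which are increasing on the first `i`
letters and on the last `j` letters. -/
def shuffles (i j : ℕ) : Finset (Equiv.Perm (Fin (i + j))) :=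
  letI := Classical.decPred fun w : Equiv.Perm (Fin (i + j)) =>
    StrictMono (fun k : Fin i => w (Fin.castAdd j k)) ∧
      StrictMono (fun k : Fin j => w (Fin.natAdd i k))
  Finset.univ.filter fun w : Equiv.Perm (Fin (i + j)) =>
    StrictMono (fun k : Fin i => w (Fin.castAdd j k)) ∧
      StrictMono (fun k : Fin j => w (Fin.natAdd i k))

section Lift

variable {K V : Type*} [Field K] [AddCommGroup V] [Module K V]

/-! ### Braidings and the lifts `T_w` -/

/-- The quantum Yang-Baxter equation on `(V ⊗ V) ⊗ V`. -/
def YangBaxter (s : V ⊗[K] V →ₗ[K] V ⊗[K] V) : Prop :=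
  let s₁ : (V ⊗[K] V) ⊗[K] V →ₗ[K] (V ⊗[K] V) ⊗[K] V := s.rTensor V
  let s₂ : (V ⊗[K] V) ⊗[K] V →ₗ[K] (V ⊗[K] V) ⊗[K] V :=
    (TensorProduct.assoc K V V V).symm.toLinearMap ∘ₗ s.lTensor V ∘ₗ
      (TensorProduct.assoc K V V V).toLinearMap
  s₁ ∘ₗ s₂ ∘ₗ s₁ = s₂ ∘ₗ s₁ ∘ₗ s₂

/-- The identification `A^{⊗1} = A`. -/
def powOne {K A : Type*} [Field K] [AddCommMonoid A] [Module K A] : ⨂[K]^1 A ≃ₗ[K] A :=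
  PiTensorProduct.subsingletonEquiv 0

/-- The identification `V^{⊗n} = V^{⊗i} ⊗ (V ⊗ V) ⊗ V^{⊗(n-i-2)}`. -/
def splitAt {n : ℕ} (i : Fin (n - 1)) :
    ⨂[K]^n V ≃ₗ[K] ⨂[K]^(i : ℕ) V ⊗[K] ((V ⊗[K] V) ⊗[K] ⨂[K]^(n - 2 - i) V) :=
  TensorPower.cast K V (show n = i + (1 + 1 + (n - 2 - i)) by omega) ≪≫ₗ
    (TensorPower.mulEquiv (R := K) (M := V)).symm ≪≫ₗ
      TensorProduct.congr (LinearEquiv.refl K _)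
        ((TensorPower.mulEquiv (R := K) (M := V)).symm ≪≫ₗ
          TensorProduct.congr
            ((TensorPower.mulEquiv (R := K) (M := V)).symm ≪≫ₗ TensorProduct.congr powOne powOne)
            (LinearEquiv.refl K _))

/-- The operator `id^{⊗i} ⊗ s ⊗ id^{⊗(n-i-2)}` on `V^{⊗n}` (with `i` counted from `0`). -/
def sigmaAt (s : V ⊗[K] V →ₗ[K] V ⊗[K] V) {n : ℕ} (i : Fin (n - 1)) :
    Module.End K (⨂[K]^n V) :=
  (splitAt i).symm.toLinearMap ∘ₗ (s.rTensor _).lTensor _ ∘ₗ (splitAt i).toLinearMap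

/-- The operator `T_w` on `V^{⊗n}`: the product `σ_{i_1} ⋯ σ_{i_l}` along a reduced expression
`w = s_{i_1} ⋯ s_{i_l}`. If `s` satisfies the Yang-Baxter equation, the choice of the reduced
expression does not matter. -/
def braidLift (s : V ⊗[K] V →ₗ[K] V ⊗[K] V) {n : ℕ} (w : Equiv.Perm (Fin n)) :
    Module.End K (⨂[K]^n V) :=
  ((reducedWord w).map (sigmaAt s)).prod

/-- `β_{ij} : V^{⊗i} ⊗ V^{⊗j} → V^{⊗j} ⊗ V^{⊗i}`, the lift of `χ_{ij}`. For `i = 0` or `j = 0` the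
permutation `χ_{ij}` is the identity, so that this is the usual flip `1 ⊗ x ↦ x ⊗ 1`. -/
def betaHom (s : V ⊗[K] V →ₗ[K] V ⊗[K] V) (i j : ℕ) :
    ⨂[K]^i V ⊗[K] ⨂[K]^j V →ₗ[K] ⨂[K]^j V ⊗[K] ⨂[K]^i V :=
  (TensorPower.mulEquiv (R := K) (M := V)).symm.toLinearMap ∘ₗ
    (TensorPower.cast K V (Nat.add_comm i j)).toLinearMap ∘ₗ
      braidLift s (chi i j) ∘ₗ (TensorPower.mulEquiv (R := K) (M := V)).toLinearMap

/-- `∑_{w ∈ 𝔖_{i,j}} T_w`, as a map `V^{⊗i} ⊗ V^{⊗j} → V^{⊗(i+j)}`. -/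
def shuffleHom (s : V ⊗[K] V →ₗ[K] V ⊗[K] V) (i j : ℕ) :
    ⨂[K]^i V ⊗[K] ⨂[K]^j V →ₗ[K] ⨂[K]^(i + j) V :=
  (∑ w ∈ shuffles i j, braidLift s w) ∘ₗ (TensorPower.mulEquiv (R := K) (M := V)).toLinearMap

end Lift

/-! ### The tensor space `T(V)`, the deconcatenation and the coproduct `Δ_β` -/

/-- The tensor space `T(V) = ⨁ V^{⊗n}` with its usual grading. -/
abbrev TSpace (K V : Type*) [Field K] [AddCommGroup V] [Module K V] : Type _ :=
  ⨁ n : ℕ, ⨂[K]^n V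

section Coproduct

variable {K V : Type*} [Field K] [AddCommGroup V] [Module K V]

/-- The inclusion `V^{⊗n} → T(V)`. -/
def incl (n : ℕ) : ⨂[K]^n V →ₗ[K] TSpace K V :=
  DirectSum.lof K ℕ (fun n => ⨂[K]^n V) n

/-- The projection `T(V) → V^{⊗n}`. -/
def proj (n : ℕ) : TSpace K V →ₗ[K] ⨂[K]^n V :=
  DirectSum.component K ℕ (fun n => ⨂[K]^n V) n

/-- The linear map on `T(V) ⊗ T(V)` with given restrictions to the summands
`V^{⊗p} ⊗ V^{⊗q}`. -/
def assemble {W : Type*} [AddCommMonoid W] [Module K W]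
    (f : ∀ p q : ℕ, ⨂[K]^p V ⊗[K] ⨂[K]^q V →ₗ[K] W) : TSpace K V ⊗[K] TSpace K V →ₗ[K] W :=
  DirectSum.toModule K (ℕ × ℕ) W (fun pq => f pq.1 pq.2) ∘ₗ
    (TensorProduct.directSum K K (fun n : ℕ => ⨂[K]^n V) (fun n : ℕ => ⨂[K]^n V)).toLinearMap

theorem assemble_incl {W : Type*} [AddCommMonoid W] [Module K W]
    (f : ∀ p q : ℕ, ⨂[K]^p V ⊗[K] ⨂[K]^q V →ₗ[K] W) (p q : ℕ) (x : ⨂[K]^p V) (y : ⨂[K]^q V) :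
    assemble f (incl p x ⊗ₜ incl q y) = f p q (x ⊗ₜ y) := by
  simp [assemble, incl, TensorProduct.directSum_lof_tmul_lof]

/-- The counit `ε` of `T(V)`: the projection onto `V^{⊗0} = K`. -/
def counit : TSpace K V →ₗ[K] K :=
  (PiTensorProduct.isEmptyEquiv (Fin 0)).toLinearMap ∘ₗ proj 0

/-- The deconcatenation `δ`, whose component `V^{⊗n} → V^{⊗i} ⊗ V^{⊗(n-i)}` is the canonical
identification, for `0 ≤ i ≤ n`. -/
def deconc : TSpace K V →ₗ[K] TSpace K V ⊗[K] TSpace K V :=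
  DirectSum.toModule K ℕ _ fun n =>
    ∑ i : Fin (n + 1),
      TensorProduct.map (incl (i : ℕ)) (incl (n - i)) ∘ₗ
        (TensorPower.mulEquiv (R := K) (M := V)).symm.toLinearMap ∘ₗ
          (TensorPower.cast K V (show n = i + (n - i) by omega)).toLinearMap

/-- The braiding `β` of `T(V)`, equal to `β_{ij}` on `V^{⊗i} ⊗ V^{⊗j}`. -/
def beta (s : V ⊗[K] V →ₗ[K] V ⊗[K] V) :
    TSpace K V ⊗[K] TSpace K V →ₗ[K] TSpace K V ⊗[K] TSpace K V :=
  assemble fun p q => TensorProduct.map (incl q) (incl p) ∘ₗ betaHom s p q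

/-- `id ⊗ f ⊗ id` on `(A ⊗ A) ⊗ (A ⊗ A)`. -/
def middle {A : Type*} [AddCommMonoid A] [Module K A] (f : A ⊗[K] A →ₗ[K] A ⊗[K] A) :
    (A ⊗[K] A) ⊗[K] (A ⊗[K] A) →ₗ[K] (A ⊗[K] A) ⊗[K] (A ⊗[K] A) :=
  (TensorProduct.assoc K A A (A ⊗[K] A)).symm.toLinearMap ∘ₗ
    ((TensorProduct.assoc K A A A).toLinearMap ∘ₗ f.rTensor A ∘ₗ
      (TensorProduct.assoc K A A A).symm.toLinearMap).lTensor A ∘ₗ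
        (TensorProduct.assoc K A A (A ⊗[K] A)).toLinearMap

/-- The coproduct `Δ_β = (id ⊗ β ⊗ id) ∘ (δ ⊗ δ)` of `T(V) ⊗ T(V)`. -/
def coprod (s : V ⊗[K] V →ₗ[K] V ⊗[K] V) :
    TSpace K V ⊗[K] TSpace K V →ₗ[K]
      (TSpace K V ⊗[K] TSpace K V) ⊗[K] (TSpace K V ⊗[K] TSpace K V) :=
  middle (beta s) ∘ₗ TensorProduct.map deconc deconc

/-- The group-like element `1 ⊗ 1` of `T(V) ⊗ T(V)`. -/
def unit₂ (K V : Type*) [Field K] [AddCommGroup V] [Module K V] :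
    TSpace K V ⊗[K] TSpace K V :=
  (1 : TSpace K V) ⊗ₜ[K] (1 : TSpace K V)

/-- The reduced coproduct `x ↦ Δ_β(x) - x ⊗ (1 ⊗ 1) - (1 ⊗ 1) ⊗ x`. -/
def redCoprod (s : V ⊗[K] V →ₗ[K] V ⊗[K] V) :
    TSpace K V ⊗[K] TSpace K V →ₗ[K]
      (TSpace K V ⊗[K] TSpace K V) ⊗[K] (TSpace K V ⊗[K] TSpace K V) :=
  coprod s +
    (-1 : K) • (TensorProduct.mk K (TSpace K V ⊗[K] TSpace K V)
      (TSpace K V ⊗[K] TSpace K V)).flip (unit₂ K V) +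
    (-1 : K) • TensorProduct.mk K (TSpace K V ⊗[K] TSpace K V)
      (TSpace K V ⊗[K] TSpace K V) (unit₂ K V)

/-- The iterated reduced coproduct `C → C^{⊗(n+1)}`, where `C = T(V) ⊗ T(V)`: one starts with the
identity, and applies `n` times the reduced coproduct to the leftmost tensor factor. In the
recursion the factor split off first, which stays on the right, is kept apart. -/
def iterRedCoprod (s : V ⊗[K] V →ₗ[K] V ⊗[K] V) : ∀ n : ℕ,
    TSpace K V ⊗[K] TSpace K V →ₗ[K] ⨂[K]^(n + 1) (TSpace K V ⊗[K] TSpace K V)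
  | 0 => powOne.symm.toLinearMap
  | n + 1 =>
    (TensorPower.mulEquiv (R := K) (M := TSpace K V ⊗[K] TSpace K V)).toLinearMap ∘ₗ
      TensorProduct.map (iterRedCoprod s n) powOne.symm.toLinearMap ∘ₗ redCoprod s

/-- `M^{⊗(n+1)}` composed with the `n`-th iterated reduced coproduct, where
`M = ⨁ M_{pq} : T(V) ⊗ T(V) → V`. -/
def powComp (s : V ⊗[K] V →ₗ[K] V ⊗[K] V)
    (M : ∀ p q : ℕ, ⨂[K]^p V ⊗[K] ⨂[K]^q V →ₗ[K] V) (n : ℕ) :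
    TSpace K V ⊗[K] TSpace K V →ₗ[K] ⨂[K]^(n + 1) V :=
  PiTensorProduct.map (fun _ : Fin (n + 1) => assemble M) ∘ₗ iterRedCoprod s n

/-- The restriction of a map on `T(V) ⊗ T(V)` to `V^{⊗i} ⊗ V^{⊗j}`. -/
def restrict {W : Type*} [AddCommMonoid W] [Module K W]
    (f : TSpace K V ⊗[K] TSpace K V →ₗ[K] W) (i j : ℕ) :
    ⨂[K]^i V ⊗[K] ⨂[K]^j V →ₗ[K] W :=
  f ∘ₗ TensorProduct.map (incl i) (incl j)

/-- The quantum shuffle product on `T(V)`. -/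
def quantumShuffle (s : V ⊗[K] V →ₗ[K] V ⊗[K] V) :
    TSpace K V ⊗[K] TSpace K V →ₗ[K] TSpace K V :=
  assemble fun i j => incl (i + j) ∘ₗ shuffleHom s i j

end Coproduct

/-! ### Quantum `B_∞`-algebras -/

/-- A braiding on `V`: an invertible solution of the quantum Yang-Baxter equation. -/
structure Braiding (K V : Type*) [Field K] [AddCommGroup V] [Module K V] where
  /-- The invertible map `σ`. -/
  sigma : V ⊗[K] V ≃ₗ[K] V ⊗[K] V
  yang_baxter : YangBaxter sigma.toLinearMap

/-- A quantum `B_∞`-algebra structure on `V`. -/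
structure QuantumBInftyAlgebra (K V : Type*) [Field K] [AddCommGroup V] [Module K V] extends
    Braiding K V where
  /-- The operations `M_{pq}`. -/
  M : ∀ p q : ℕ, ⨂[K]^p V ⊗[K] ⨂[K]^q V →ₗ[K] V
  M_zero_zero : M 0 0 = 0
  M_one_zero : ∀ v : V, M 1 0 (powOne.symm v ⊗ₜ PiTensorProduct.tprod K Fin.elim0) = v
  M_zero_one : ∀ v : V, M 0 1 (PiTensorProduct.tprod K Fin.elim0 ⊗ₜ powOne.symm v) = v
  M_ge_two_zero : ∀ n : ℕ, 2 ≤ n → M n 0 = 0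
  M_zero_ge_two : ∀ n : ℕ, 2 ≤ n → M 0 n = 0
  /-- `β_{1k} (M_{ij} ⊗ id^{⊗k}) = (id^{⊗k} ⊗ M_{ij}) β_{i+j,k}` -/
  yang_baxter_left : ∀ i j k : ℕ, 1 ≤ i → 1 ≤ j → 1 ≤ k →
    betaHom sigma.toLinearMap 1 k ∘ₗ
        TensorProduct.map (powOne.symm.toLinearMap ∘ₗ M i j) LinearMap.id =
      TensorProduct.map LinearMap.id
          (powOne.symm.toLinearMap ∘ₗ M i j ∘ₗ
            (TensorPower.mulEquiv (R := K) (M := V)).symm.toLinearMap) ∘ₗ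
        betaHom sigma.toLinearMap (i + j) k ∘ₗ
          TensorProduct.map (TensorPower.mulEquiv (R := K) (M := V)).toLinearMap LinearMap.id
  /-- `β_{i1} (id^{⊗i} ⊗ M_{jk}) = (M_{jk} ⊗ id^{⊗i}) β_{i,j+k}` -/
  yang_baxter_right : ∀ i j k : ℕ, 1 ≤ i → 1 ≤ j → 1 ≤ k →
    betaHom sigma.toLinearMap i 1 ∘ₗ
        TensorProduct.map LinearMap.id (powOne.symm.toLinearMap ∘ₗ M j k) =
      TensorProduct.map
          (powOne.symm.toLinearMap ∘ₗ M j k ∘ₗ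
            (TensorPower.mulEquiv (R := K) (M := V)).symm.toLinearMap) LinearMap.id ∘ₗ
        betaHom sigma.toLinearMap i (j + k) ∘ₗ
          TensorProduct.map LinearMap.id (TensorPower.mulEquiv (R := K) (M := V)).toLinearMap
  /-- The associativity condition on `(V^{⊗i} ⊗ V^{⊗j}) ⊗ V^{⊗k}`; the summation indices are
  shifted by one. -/
  assoc : ∀ i j k : ℕ, 1 ≤ i → 1 ≤ j → 1 ≤ k →
    (∑ r ∈ Finset.range (i + j),
        M (r + 1) k ∘ₗ
          TensorProduct.map (restrict (powComp sigma.toLinearMap M r) i j) LinearMap.id) =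
      (∑ l ∈ Finset.range (j + k),
        M i (l + 1) ∘ₗ
          TensorProduct.map LinearMap.id (restrict (powComp sigma.toLinearMap M l) j k)) ∘ₗ
        (TensorProduct.assoc K (⨂[K]^i V) (⨂[K]^j V) (⨂[K]^k V)).toLinearMap

/-! ### The product `*` -/

section Star

variable {K V : Type*} [Field K] [AddCommGroup V] [Module K V]

/-- The homogeneous tensors of total degree `n` in `T(V) ⊗ T(V)`. -/
def homog (K V : Type*) [Field K] [AddCommGroup V] [Module K V] (n : ℕ) :
    Submodule K (TSpace K V ⊗[K] TSpace K V) :=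
  Submodule.span K {t | ∃ (i j : ℕ) (x : ⨂[K]^i V) (y : ⨂[K]^j V),
    i + j = n ∧ t = incl i x ⊗ₜ incl j y}

theorem map_incl_mem (i j : ℕ) (t : ⨂[K]^i V ⊗[K] ⨂[K]^j V) :
    TensorProduct.map (incl i) (incl j) t ∈ homog K V (i + j) := by
  induction t with
  | zero => simp
  | tmul x y => exact Submodule.subset_span ⟨i, j, x, y, rfl, rfl⟩
  | add a b ha hb => rw [map_add]; exact add_mem ha hb

theorem map_incl_mem_range (i j : ℕ) (t : ⨂[K]^i V ⊗[K] ⨂[K]^j V) :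
    TensorProduct.map (incl i) (incl j) t ∈ Submodule.span K
      {t | ∃ (x : ⨂[K]^i V) (y : ⨂[K]^j V), t = incl i x ⊗ₜ[K] incl j y} := by
  induction t with
  | zero => simp
  | tmul x y => exact Submodule.subset_span ⟨x, y, rfl⟩
  | add a b ha hb => rw [map_add]; exact add_mem ha hb

/-- If a linear map kills all tensors `(a ⊗ b) ⊗ (c ⊗ d)` with homogeneous entries of total degree
`n`, then it kills the coproduct of a homogeneous tensor of degree `n`. -/
theorem coprod_eq_zero {W : Type*} [AddCommMonoid W] [Module K W]
    (s : V ⊗[K] V →ₗ[K] V ⊗[K] V)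
    (f : (TSpace K V ⊗[K] TSpace K V) ⊗[K] (TSpace K V ⊗[K] TSpace K V) →ₗ[K] W) (n : ℕ)
    (hf : ∀ (p q : ℕ), p + q = n → ∀ a ∈ homog K V p, ∀ b ∈ homog K V q, f (a ⊗ₜ b) = 0)
    (t : TSpace K V ⊗[K] TSpace K V) (ht : t ∈ homog K V n) : f (coprod s t) = 0 := by
  have key : ∀ (i j k l : ℕ), i + j + (k + l) = n →
      ∀ (t₁ : ⨂[K]^i V ⊗[K] ⨂[K]^j V) (t₂ : ⨂[K]^k V ⊗[K] ⨂[K]^l V),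
      f (middle (beta s) (TensorProduct.map (incl i) (incl j) t₁ ⊗ₜ
        TensorProduct.map (incl k) (incl l) t₂)) = 0 := by
    intro i j k l h t₁ t₂
    induction t₁ with
    | zero => simp
    | add a b ha hb => simp only [map_add, TensorProduct.add_tmul, ha, hb, add_zero]
    | tmul x y =>
      induction t₂ with
      | zero => simp
      | add a b ha hb => simp only [map_add, TensorProduct.tmul_add, ha, hb, add_zero]
      | tmul z w =>
        simp only [TensorProduct.map_tmul, middle, LinearMap.comp_apply,
          LinearEquiv.coe_coe, TensorProduct.assoc_tmul, LinearMap.lTensor_tmul,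
          TensorProduct.assoc_symm_tmul, LinearMap.rTensor_tmul]
        rw [beta, assemble_incl, LinearMap.comp_apply]
        generalize betaHom s j k (y ⊗ₜ z) = t₃
        induction t₃ with
        | zero => simp
        | add a b ha hb =>
          simp only [map_add, TensorProduct.tmul_add, TensorProduct.add_tmul, ha, hb, add_zero]
        | tmul z' y' =>
          simp only [TensorProduct.map_tmul, TensorProduct.assoc_tmul,
            TensorProduct.assoc_symm_tmul]
          exact hf (i + k) (j + l) (by omega) _
            (Submodule.subset_span ⟨i, k, x, z', rfl, rfl⟩) _
            (Submodule.subset_span ⟨j, l, y', w, rfl, rfl⟩)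
  induction ht using Submodule.span_induction with
  | zero => simp
  | add a b _ _ ha hb => simp [ha, hb]
  | smul c a _ ha => simp [ha]
  | mem t ht =>
    obtain ⟨i, j, x, y, hij, rfl⟩ := ht
    simp only [coprod, LinearMap.comp_apply, TensorProduct.map_tmul]
    simp only [deconc, incl, DirectSum.toModule_lof]
    simp only [LinearMap.sum_apply, TensorProduct.sum_tmul, TensorProduct.tmul_sum, map_sum,
      LinearMap.comp_apply]
    refine Finset.sum_eq_zero fun k _ => Finset.sum_eq_zero fun l _ => ?_
    exact key _ _ _ _ (by omega) _ _

theorem unit₂_mem : unit₂ K V ∈ homog K V 0 :=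
  Submodule.subset_span ⟨0, 0, PiTensorProduct.tprod K Fin.elim0,
    PiTensorProduct.tprod K Fin.elim0, rfl, rfl⟩

theorem map_mulEquiv {A B : Type*} [AddCommMonoid A] [Module K A] [AddCommMonoid B] [Module K B]
    (f : A →ₗ[K] B) (n m : ℕ) (x : ⨂[K]^n A) (y : ⨂[K]^m A) :
    PiTensorProduct.map (fun _ : Fin (n + m) => f)
        (TensorPower.mulEquiv (R := K) (M := A) (x ⊗ₜ y)) =
      TensorPower.mulEquiv (R := K) (M := B)
        (PiTensorProduct.map (fun _ => f) x ⊗ₜ PiTensorProduct.map (fun _ => f) y) := by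
  induction x using PiTensorProduct.induction_on with
  | add a b ha hb => simp only [TensorProduct.add_tmul, map_add, ha, hb]
  | smul_tprod r x =>
    induction y using PiTensorProduct.induction_on with
    | add a b ha hb => simp only [TensorProduct.tmul_add, map_add, ha, hb]
    | smul_tprod r' y =>
      simp only [← TensorProduct.smul_tmul', TensorProduct.tmul_smul, map_smul,
        PiTensorProduct.map_tprod]
      congr 2
      have h1 := TensorPower.tprod_mul_tprod K x y
      have h2 := TensorPower.tprod_mul_tprod K (fun i => f (x i)) (fun i => f (y i))
      rw [TensorPower.gMul_def] at h1 h2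
      rw [h1, h2, PiTensorProduct.map_tprod]
      congr 1
      funext i
      refine Fin.addCases (fun i => ?_) (fun i => ?_) i <;> simp

/-- `M^{⊗(n+1)}` composed with the `n`-th iterated reduced coproduct vanishes on tensors of degree
at most `n`. -/
theorem powComp_eq_zero (s : V ⊗[K] V →ₗ[K] V ⊗[K] V)
    (M : ∀ p q : ℕ, ⨂[K]^p V ⊗[K] ⨂[K]^q V →ₗ[K] V) (hM : M 0 0 = 0) (n m : ℕ) (hmn : m ≤ n)
    (t : TSpace K V ⊗[K] TSpace K V) (ht : t ∈ homog K V m) : powComp s M n t = 0 := by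
  have h0 : ∀ a ∈ homog K V 0, assemble M a = 0 := by
    intro a ha
    induction ha using Submodule.span_induction with
    | zero => simp
    | add a b _ _ ha hb => simp [ha, hb]
    | smul c a _ ha => simp [ha]
    | mem t ht =>
      obtain ⟨i, j, x, y, hij, rfl⟩ := ht
      obtain ⟨rfl, rfl⟩ : i = 0 ∧ j = 0 := by omega
      rw [assemble_incl, hM, LinearMap.zero_apply]
  induction n generalizing m t with
  | zero =>
    obtain rfl : m = 0 := by omega
    simp only [powComp, iterRedCoprod, powOne, LinearMap.comp_apply, LinearEquiv.coe_coe]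
    rw [PiTensorProduct.subsingletonEquiv_symm_apply, PiTensorProduct.map_tprod]
    exact MultilinearMap.map_coord_zero _ (0 : Fin 1) (h0 t ht)
  | succ n ih =>
    have hf : ∀ a b : TSpace K V ⊗[K] TSpace K V,
        PiTensorProduct.map (fun _ : Fin (n + 1 + 1) => assemble M)
          (TensorPower.mulEquiv (R := K) (M := TSpace K V ⊗[K] TSpace K V)
            (TensorProduct.map (iterRedCoprod s n) powOne.symm.toLinearMap (a ⊗ₜ b))) =
        TensorPower.mulEquiv (R := K) (M := V)
          (powComp s M n a ⊗ₜ powOne.symm (assemble M b)) := by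
      intro a b
      rw [TensorProduct.map_tmul, map_mulEquiv]
      congr 2
      simp only [powOne, LinearEquiv.coe_coe]
      rw [PiTensorProduct.subsingletonEquiv_symm_apply',
        PiTensorProduct.subsingletonEquiv_symm_apply', PiTensorProduct.map_tprod]
    set F := PiTensorProduct.map (fun _ : Fin (n + 1 + 1) => assemble M) ∘ₗ
      (TensorPower.mulEquiv (R := K) (M := TSpace K V ⊗[K] TSpace K V)).toLinearMap ∘ₗ
        TensorProduct.map (iterRedCoprod s n) powOne.symm.toLinearMap with hF
    have hF' : ∀ a b, F (a ⊗ₜ b) = TensorPower.mulEquiv (R := K) (M := V)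
          (powComp s M n a ⊗ₜ powOne.symm (assemble M b)) := hf
    have h1 : F (coprod s t) = 0 := by
      refine coprod_eq_zero s F m (fun p q hpq a ha b hb => ?_) t ht
      rw [hF']
      rcases Nat.eq_zero_or_pos q with rfl | hq
      · rw [h0 b hb]; simp
      · rw [ih p (by omega) a ha]; simp
    have h2 : F (t ⊗ₜ unit₂ K V) = 0 := by rw [hF', h0 _ unit₂_mem]; simp
    have h3 : F (unit₂ K V ⊗ₜ t) = 0 := by rw [hF', ih 0 (Nat.zero_le _) _ unit₂_mem]; simp
    have h4 : powComp s M (n + 1) t = F (redCoprod s t) := rfl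
    rw [h4]
    simp only [redCoprod, LinearMap.add_apply, LinearMap.smul_apply, map_add, map_smul,
      LinearMap.flip_apply, TensorProduct.mk_apply, h1, h2, h3, smul_zero, add_zero]

/-- The summands of `*`, as maps to `T(V)`: the summand with index `0` is `ε ⊗ ε`, and for
`n ≥ 1` the summand with index `n` is `M^{⊗n}` composed with the `(n-1)`-st iterated reduced
coproduct. -/
def starTerm (A : QuantumBInftyAlgebra K V) :
    ℕ → TSpace K V ⊗[K] TSpace K V →ₗ[K] TSpace K V
  | 0 =>
    (LinearMap.toSpanSingleton K (TSpace K V) 1) ∘ₗ (TensorProduct.lid K K).toLinearMap ∘ₗ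
      TensorProduct.map counit counit
  | n + 1 => incl (n + 1) ∘ₗ powComp A.sigma.toLinearMap A.M n

theorem starTerm_finite (A : QuantumBInftyAlgebra K V) (t : TSpace K V ⊗[K] TSpace K V) :
    (Function.support fun n => starTerm A n t).Finite := by
  induction t with
  | zero => simp
  | add a b ha hb =>
    refine (ha.union hb).subset ?_
    simp only [map_add]
    exact Function.support_add _ _
  | tmul x y =>
    induction x using DirectSum.induction_on with
    | zero => simp
    | add a b ha hb =>
      refine (ha.union hb).subset ?_
      simp only [TensorProduct.add_tmul, map_add]
      exact Function.support_add _ _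
    | of i x =>
      induction y using DirectSum.induction_on with
      | zero => simp
      | add a b ha hb =>
        refine (ha.union hb).subset ?_
        simp only [TensorProduct.tmul_add, map_add]
        exact Function.support_add _ _
      | of j y =>
        refine (Set.finite_Iic (i + j)).subset fun n hn => ?_
        by_contra hlt
        rw [Set.mem_Iic, not_le] at hlt
        refine hn ?_
        obtain ⟨n, rfl⟩ : ∃ k, n = k + 1 := ⟨n - 1, by omega⟩
        have h := powComp_eq_zero A.sigma.toLinearMap A.M A.M_zero_zero n (i + j) (by omega)
          (incl i x ⊗ₜ incl j y) (Submodule.subset_span ⟨i, j, x, y, rfl, rfl⟩)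
        have h' : starTerm A (n + 1) (incl i x ⊗ₜ incl j y) = 0 := by
          simp only [starTerm, LinearMap.comp_apply, h, map_zero]
        exact h'

/-- The product `* = ε ⊗ ε + ∑_{n ≥ 1} M^{⊗n} ∘ \bar Δ_β^{(n-1)}` on `T(V)`; the sum is finite on
every element. -/
def starProd (A : QuantumBInftyAlgebra K V) : TSpace K V ⊗[K] TSpace K V →ₗ[K] TSpace K V where
  toFun t := ∑ᶠ n, starTerm A n t
  map_add' a b := by
    simp only [map_add]
    exact finsum_add_distrib (starTerm_finite A a) (starTerm_finite A b)
  map_smul' c a := by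
    simp only [map_smul, RingHom.id_apply]
    exact (smul_finsum' c (starTerm_finite A a)).symm

end Star

end QuantumBInfty

/-! The map $M^{\otimes(n+1)}\circ\overline\Delta_\beta^{(n)}$ kills everything of total degree at
most $n$: of $n+1$ factors one would have degree $0$, and $M_{00}=0$ (`powComp_eq_zero`). Since the
summand of $\ast$ with index $m$ takes values in $V^{\otimes m}$, this gives the vanishing above
degree $i+j$, and the top component is the single summand with $m=i+j$. It remains to evaluate
$M^{\otimes(n+1)}\circ\overline\Delta_\beta^{(n)}$ in degree exactly $n+1$ (`powComp_incl`), by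
induction on $n$.

Going from $n$ to $n+1$, the outermost coproduct cuts $x=x_1x_2$ and $y=y_1y_2$ and braids $x_2$
past $y_1$. By the vanishing, the right factor, built from $x_2$ and $y_2$, must have degree $1$,
where $M$ is the identity. Two cuts survive (`sum_fin_succ_succ`). If the last letter of $y$ is
split off, nothing is braided (`cutTerm_right`). If the last letter of $x$ is split off, it first
crosses all of $y$ by $\beta_{1j}$ (`cutTerm_left`). The induction hypothesis applies to the left
factor.

Shuffles obey the same recursion (`sum_shuf_succ`): the letter placed last ends one of the two
blocks. In the first case the shuffle is a shorter one $u$ extended by a fixed last letter, and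
$T_{\mathrm{emb}(u)}=T_u\otimes\mathrm{id}$. In the second it is $\mathrm{emb}(u)\,c$, where the
cycle $c$ moves the last letter of $x$ to the end. Lengths add in this product, so
$T_{\mathrm{emb}(u)c}=T_{\mathrm{emb}(u)}T_c$, and $T_c$ acts as $\mathrm{id}\otimes\beta_{1j}$.

Multiplicativity of $T$ along such factorizations needs independence of the chosen reduced word.
This is Matsumoto's theorem (`Lifts.unique`), applied to the $\sigma_i$, which satisfy the braid
relations by the Yang–Baxter equation (`braidRelations_sigmaAt`). -/

namespace QuantumBInfty

/-! ### Lifts of permutations along ascents -/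

/-- The lower letter exchanged by `simpleSwap n k`. -/
def lo {n : ℕ} (k : Fin (n - 1)) : Fin n := ⟨k, by omega⟩

/-- The upper letter exchanged by `simpleSwap n k`. -/
def hi {n : ℕ} (k : Fin (n - 1)) : Fin n := ⟨k + 1, by omega⟩

@[simp] theorem lo_val {n : ℕ} (k : Fin (n - 1)) : (lo k : ℕ) = k := rfl

@[simp] theorem hi_val {n : ℕ} (k : Fin (n - 1)) : (hi k : ℕ) = k + 1 := rfl

theorem lo_lt_hi {n : ℕ} (k : Fin (n - 1)) : lo k < hi k := Nat.lt_succ_self _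

theorem lo_ne_hi {n : ℕ} (k : Fin (n - 1)) : lo k ≠ hi k := by simp [Fin.ext_iff]

@[simp] theorem simpleSwap_lo {n : ℕ} (k : Fin (n - 1)) : simpleSwap n k (lo k) = hi k :=
  Equiv.swap_apply_left _ _

@[simp] theorem simpleSwap_hi {n : ℕ} (k : Fin (n - 1)) : simpleSwap n k (hi k) = lo k :=
  Equiv.swap_apply_right _ _

theorem simpleSwap_of_ne {n : ℕ} (k : Fin (n - 1)) (a : Fin n) (h : (a : ℕ) ≠ k)
    (h' : (a : ℕ) ≠ (k : ℕ) + 1) : simpleSwap n k a = a :=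
  Equiv.swap_apply_of_ne_of_ne (by simpa [Fin.ext_iff] using h) (by simpa [Fin.ext_iff] using h')

theorem simpleSwap_val {n : ℕ} (k : Fin (n - 1)) (a : Fin n) :
    (simpleSwap n k a : ℕ) = if (a : ℕ) = k then (k : ℕ) + 1 else if (a : ℕ) = (k : ℕ) + 1 then (k : ℕ) else a := by
  rw [simpleSwap, Equiv.swap_apply_def]
  simp only [Fin.ext_iff]
  split_ifs <;> rfl

@[simp] theorem simpleSwap_mul_self {n : ℕ} (k : Fin (n - 1)) :
    simpleSwap n k * simpleSwap n k = 1 := Equiv.swap_mul_self _ _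

@[simp] theorem mul_simpleSwap_cancel {n : ℕ} (w : Equiv.Perm (Fin n)) (k : Fin (n - 1)) :
    w * simpleSwap n k * simpleSwap n k = w := by rw [mul_assoc, simpleSwap_mul_self, mul_one]

@[simp] theorem simpleSwap_inv {n : ℕ} (k : Fin (n - 1)) :
    (simpleSwap n k)⁻¹ = simpleSwap n k := Equiv.swap_inv _ _

theorem inv_apply_cancel {n : ℕ} (w : Equiv.Perm (Fin n)) (a : Fin n) : w⁻¹ (w a) = a :=
  w.symm_apply_apply a

/-! ### Inversions, ascents and descents -/

/-- The inversions of `w`, recorded as pairs of values. -/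
def inversions {n : ℕ} (w : Equiv.Perm (Fin n)) : Finset (Fin n × Fin n) :=
  Finset.univ.filter fun p => p.1 < p.2 ∧ w⁻¹ p.2 < w⁻¹ p.1

/-- Right multiplication by a simple transposition exchanges two adjacent positions, so only the
relative order of the two values standing there changes. Recording inversions by values rather than
positions makes this the insertion of one pair. -/
theorem inversions_mul_simpleSwap {n : ℕ} (w : Equiv.Perm (Fin n)) (k : Fin (n - 1))
    (h : w (lo k) < w (hi k)) :
    inversions (w * simpleSwap n k) = insert (w (lo k), w (hi k)) (inversions w) := by
  ext ⟨a, b⟩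
  obtain ⟨a, rfl⟩ := w.surjective a
  obtain ⟨b, rfl⟩ := w.surjective b
  simp only [inversions, mul_inv_rev, simpleSwap_inv, Finset.mem_filter, Finset.mem_univ,
    true_and, Equiv.Perm.mul_apply, inv_apply_cancel, Finset.mem_insert, Prod.mk.injEq,
    EmbeddingLike.apply_eq_iff_eq]
  by_cases h1 : a = lo k ∧ b = hi k
  · obtain ⟨rfl, rfl⟩ := h1
    simp [h, lo_lt_hi]
  by_cases h2 : a = hi k ∧ b = lo k
  · obtain ⟨rfl, rfl⟩ := h2
    simp [h.asymm, (lo_ne_hi k).symm]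
  have : simpleSwap n k b < simpleSwap n k a ↔ b < a := by
    simp only [Fin.lt_def, simpleSwap_val]
    simp only [Fin.ext_iff, lo_val, hi_val] at h1 h2
    split_ifs <;> omega
  simp [h1, this]

theorem card_inversions_mul_simpleSwap {n : ℕ} (w : Equiv.Perm (Fin n)) (k : Fin (n - 1))
    (h : w (lo k) < w (hi k)) :
    (inversions (w * simpleSwap n k)).card = (inversions w).card + 1 := by
  rw [inversions_mul_simpleSwap w k h, Finset.card_insert_of_notMem]
  simp [inversions, (lo_lt_hi k).asymm]

theorem card_inversions_of_descent {n : ℕ} (w : Equiv.Perm (Fin n)) (k : Fin (n - 1))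
    (h : w (hi k) < w (lo k)) :
    (inversions w).card = (inversions (w * simpleSwap n k)).card + 1 := by
  have := card_inversions_mul_simpleSwap (w * simpleSwap n k) k (by simpa using h)
  rwa [mul_simpleSwap_cancel] at this

theorem lt_or_gt_lo_hi {n : ℕ} (w : Equiv.Perm (Fin n)) (k : Fin (n - 1)) :
    w (lo k) < w (hi k) ∨ w (hi k) < w (lo k) :=
  lt_or_gt_of_ne fun h => lo_ne_hi k (w.injective h)

/-- Ascents everywhere make `w` an order automorphism of a finite chain, and the identity is the
only one. -/
theorem eq_one_of_ascents {n : ℕ} (w : Equiv.Perm (Fin n))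
    (h : ∀ k : Fin (n - 1), w (lo k) < w (hi k)) : w = 1 := by
  cases n with
  | zero => exact Subsingleton.elim _ _
  | succ n =>
    have hw : StrictMono w := Fin.strictMono_iff_lt_succ.2 fun i => h i
    have : (hw.orderIsoOfSurjective w w.surjective) = OrderIso.refl _ := Subsingleton.elim _ _
    ext i
    exact congrArg Fin.val (DFunLike.congr_fun this i)

/-- Induction on permutations, multiplying on the right with simple transpositions at
ascents. -/
theorem ascent_induction {n : ℕ} {P : Equiv.Perm (Fin n) → Prop} (one : P 1)
    (step : ∀ w k, w (lo k) < w (hi k) → P w → P (w * simpleSwap n k)) (w) : P w := by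
  induction hN : (inversions w).card using Nat.strong_induction_on generalizing w with
  | _ N ih =>
    by_cases h : ∀ k : Fin (n - 1), w (lo k) < w (hi k)
    · rw [eq_one_of_ascents w h]; exact one
    · push Not at h
      obtain ⟨k, hk⟩ := h
      have hk := (lt_or_gt_lo_hi w k).resolve_left hk.not_gt
      have hc := card_inversions_of_descent w k hk
      have := step (w * simpleSwap n k) k (by simpa using hk) (ih _ (by omega) _ rfl)
      rwa [mul_simpleSwap_cancel] at this

/-! ### Matsumoto's theorem -/

section Lifts

variable {n : ℕ} {R : Type*} [Monoid R]

/-- `x` is a product `f i₁ ⋯ f iₗ` such that `w = s_{i₁} ⋯ s_{iₗ}`, every factor being attached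
at an ascent. -/
inductive Lifts (f : Fin (n - 1) → R) : Equiv.Perm (Fin n) → R → Prop
  | one : Lifts f 1 1
  | step (w : Equiv.Perm (Fin n)) (x : R) (k : Fin (n - 1)) (hk : w (lo k) < w (hi k))
      (h : Lifts f w x) : Lifts f (w * simpleSwap n k) (x * f k)

theorem Lifts.exists (f : Fin (n - 1) → R) (w : Equiv.Perm (Fin n)) : ∃ x, Lifts f w x :=
  ascent_induction (P := fun w => ∃ x, Lifts f w x) ⟨1, .one⟩ (fun w k hk ⟨x, hx⟩ => ⟨_, .step w x k hk hx⟩) w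

/-- The relations between simple transpositions are needed alongside those of `f`: they show that
two descending paths from `w` meet in the same permutation. -/
theorem simpleSwap_comm (k m : Fin (n - 1)) (h : (k : ℕ) + 1 < m) :
    simpleSwap n k * simpleSwap n m = simpleSwap n m * simpleSwap n k := by
  ext a
  simp only [Equiv.Perm.mul_apply, simpleSwap_val]
  split_ifs <;> omega

theorem simpleSwap_braid (k m : Fin (n - 1)) (h : (k : ℕ) + 1 = m) :
    simpleSwap n k * simpleSwap n m * simpleSwap n k =
      simpleSwap n m * simpleSwap n k * simpleSwap n m := by
  have e : hi k = lo m := Fin.ext h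
  have h1 : simpleSwap n k = Equiv.swap (lo k) (lo m) := by rw [← e]; rfl
  have h2 : simpleSwap n m = Equiv.swap (lo m) (hi m) := rfl
  have n1 : lo k ≠ lo m := e ▸ lo_ne_hi k
  have n2 : lo k ≠ hi m := by simp only [ne_eq, Fin.ext_iff, lo_val, hi_val]; omega
  rw [h1, h2, Equiv.swap_mul_swap_mul_swap n1 n2, Equiv.swap_comm (lo k) (lo m),
    Equiv.swap_comm (lo m) (hi m), Equiv.swap_mul_swap_mul_swap (lo_ne_hi m).symm n2.symm,
    Equiv.swap_comm]

/-- The braid relations. -/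
structure BraidRelations (f : Fin (n - 1) → R) : Prop where
  comm : ∀ k m : Fin (n - 1), (k : ℕ) + 1 < m → f k * f m = f m * f k
  braid : ∀ k m : Fin (n - 1), (k : ℕ) + 1 = m → f k * f m * f k = f m * f k * f m

/-- Matsumoto's theorem for the symmetric group. -/
theorem Lifts.unique {f : Fin (n - 1) → R} (hf : BraidRelations f) {w : Equiv.Perm (Fin n)}
    {x y : R} (hx : Lifts f w x) (hy : Lifts f w y) : x = y := by
  induction hN : (inversions w).card using Nat.strong_induction_on generalizing w x y with
  | _ N ih =>
    subst hN
    have ih' : ∀ (k) (x y : R), w (hi k) < w (lo k) → Lifts f (w * simpleSwap n k) x →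
        Lifts f (w * simpleSwap n k) y → x = y := fun k x y hk hx hy =>
      ih _ (by have := card_inversions_of_descent w k hk; omega) hx hy rfl
    have far : ∀ (k m : Fin (n - 1)) (x y : R), (k : ℕ) + 1 < m → w (hi k) < w (lo k) →
        w (hi m) < w (lo m) → Lifts f (w * simpleSwap n k) x →
        Lifts f (w * simpleSwap n m) y → x * f k = y * f m := by
      intro k m x y h hk hm hx hy
      -- For distant letters the common lower permutation is $ws_ks_m=ws_ms_k$. From its lift `q`,
      -- the induction hypothesis gives $x=q f_m$ and $y=q f_k$.
      obtain ⟨q, hq⟩ := Lifts.exists f (w * simpleSwap n k * simpleSwap n m)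
      have e1 : simpleSwap n k (hi m) = hi m := simpleSwap_of_ne _ _ (by simp; omega) (by simp; omega)
      have e2 : simpleSwap n k (lo m) = lo m := simpleSwap_of_ne _ _ (by simp; omega) (by simp; omega)
      have e3 : simpleSwap n m (hi k) = hi k := simpleSwap_of_ne _ _ (by simp; omega) (by simp; omega)
      have e4 : simpleSwap n m (lo k) = lo k := simpleSwap_of_ne _ _ (by simp; omega) (by simp; omega)
      have h1 := Lifts.step _ q m (by simpa [e1, e2] using hm) hq
      rw [mul_simpleSwap_cancel] at h1
      rw [mul_assoc, simpleSwap_comm k m h, ← mul_assoc] at hq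
      have h2 := Lifts.step _ q k (by simpa [e3, e4] using hk) hq
      rw [mul_simpleSwap_cancel] at h2
      rw [ih' k _ _ hk hx h1, ih' m _ _ hm hy h2, mul_assoc, mul_assoc, hf.comm k m h]
    have near : ∀ (k m : Fin (n - 1)) (x y : R), (k : ℕ) + 1 = m → w (hi k) < w (lo k) →
        w (hi m) < w (lo m) → Lifts f (w * simpleSwap n k) x →
        Lifts f (w * simpleSwap n m) y → x * f k = y * f m := by
      intro k m x y h hk hm hx hy
      -- For adjacent letters `w` reverses three consecutive positions, so one can descend three
      -- times, to $ws_ks_ms_k=ws_ms_ks_m$. Climbing back gives $x=q f_k f_m$ and $y=q f_m f_k$.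
      obtain ⟨q, hq⟩ := Lifts.exists f (w * simpleSwap n k * simpleSwap n m * simpleSwap n k)
      have e0 : hi k = lo m := Fin.ext h
      have e1 : simpleSwap n k (hi m) = hi m := simpleSwap_of_ne _ _ (by simp; omega) (by simp; omega)
      have e2 : simpleSwap n k (lo m) = lo k := by rw [← e0, simpleSwap_hi]
      have e3 : simpleSwap n m (hi k) = hi m := by rw [e0, simpleSwap_lo]
      have e4 : simpleSwap n m (lo k) = lo k := simpleSwap_of_ne _ _ (by simp; omega) (by simp; omega)
      have hkm : w (hi m) < w (lo k) := hm.trans (by rwa [← e0])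
      have h1 := Lifts.step _ _ k (by simpa [e1, e2, e3, e4, e0] using hm) hq
      rw [mul_simpleSwap_cancel] at h1
      have h1 := Lifts.step _ _ m (by simpa [e1, e2, e3, e4] using hkm) h1
      rw [mul_simpleSwap_cancel] at h1
      rw [mul_assoc, mul_assoc, ← mul_assoc (simpleSwap n k), simpleSwap_braid k m h,
        ← mul_assoc, ← mul_assoc] at hq
      have h2 := Lifts.step _ _ m (by simpa [e1, e2, e3, e4, ← e0] using hk) hq
      rw [mul_simpleSwap_cancel] at h2
      have h2 := Lifts.step _ _ k (by simpa [e1, e2, e3, e4] using hkm) h2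
      rw [mul_simpleSwap_cancel] at h2
      rw [ih' k _ _ hk hx h1, ih' m _ _ hm hy h2]
      simpa only [mul_assoc] using congrArg (q * ·) (hf.braid k m h)
    have inv : ∀ {z}, Lifts f w z → (w = 1 ∧ z = 1) ∨ ∃ k z', w (hi k) < w (lo k) ∧
        Lifts f (w * simpleSwap n k) z' ∧ z = z' * f k := by
      intro z hz
      cases hz with
      | one => exact .inl ⟨rfl, rfl⟩
      | step u z' k hk hu => exact .inr ⟨k, z', by simpa using hk, by simpa using hu, rfl⟩
    rcases inv hx with ⟨rfl, rfl⟩ | ⟨k, x', hk, hx', rfl⟩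
    · rcases inv hy with ⟨-, rfl⟩ | ⟨m, y', hm, -⟩
      · rfl
      · exact absurd hm (lo_lt_hi m).asymm
    · rcases inv hy with ⟨rfl, rfl⟩ | ⟨m, y', hm, hy', rfl⟩
      · exact absurd hk (lo_lt_hi k).asymm
      · rcases lt_trichotomy (k : ℕ) m with h | h | h
        · rcases Nat.lt_or_eq_of_le (Nat.succ_le_of_lt h) with h | h
          · exact far k m _ _ h hk hm hx' hy'
          · exact near k m _ _ h hk hm hx' hy'
        · obtain rfl := Fin.ext h
          rw [ih' k _ _ hk hx' hy']
        · rcases Nat.lt_or_eq_of_le (Nat.succ_le_of_lt h) with h | h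
          · exact (far m k _ _ h hm hk hy' hx').symm
          · exact (near m k _ _ h hm hk hy' hx').symm

end Lifts

/-! ### Reduced words and the number of inversions -/

theorem card_inversions_le_length {n : ℕ} (l : List (Fin (n - 1))) :
    (inversions (l.map (simpleSwap n)).prod).card ≤ l.length := by
  induction l using List.reverseRecOn with
  | nil =>
    simp only [List.map_nil, List.prod_nil, List.length_nil, Nat.le_zero, Finset.card_eq_zero]
    ext ⟨a, b⟩
    simpa [inversions] using fun h => le_of_lt h
  | append_singleton l k ih =>
    simp only [List.map_append, List.map_cons, List.map_nil, List.prod_append, List.prod_cons,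
      List.prod_nil, mul_one, List.length_append, List.length_cons, List.length_nil]
    set w := (l.map (simpleSwap n)).prod
    rcases lt_or_gt_lo_hi w k with h | h
    · have := card_inversions_mul_simpleSwap w k h; omega
    · have := card_inversions_of_descent w k h; omega

theorem exists_word_length_eq {n : ℕ} (w : Equiv.Perm (Fin n)) :
    ∃ l : List (Fin (n - 1)), (l.map (simpleSwap n)).prod = w ∧
      l.length = (inversions w).card := by
  induction w using ascent_induction with
  | one => exact ⟨[], rfl, (Nat.le_zero.1 (card_inversions_le_length [])).symm⟩
  | step w k hk ih =>
    obtain ⟨l, hl, hc⟩ := ih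
    exact ⟨l ++ [k], by simp [hl], by simp [hc, card_inversions_mul_simpleSwap w k hk]⟩

theorem IsReducedWord.length_eq {n : ℕ} {w : Equiv.Perm (Fin n)} {l : List (Fin (n - 1))}
    (h : IsReducedWord w l) : l.length = (inversions w).card := by
  obtain ⟨l', hl', hc⟩ := exists_word_length_eq w
  exact le_antisymm (hc ▸ h.2 l' hl') (h.1 ▸ card_inversions_le_length l)

/-- A reduced word is exactly as long as the number of inversions, and each letter changes that
number by one, so every letter has to be attached at an ascent. This connects the chosen reduced
word with `Lifts`. -/
theorem IsReducedWord.lifts {n : ℕ} {R : Type*} [Monoid R] (f : Fin (n - 1) → R)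
    {w : Equiv.Perm (Fin n)} {l : List (Fin (n - 1))} (h : IsReducedWord w l) :
    Lifts f w (l.map f).prod := by
  induction l using List.reverseRecOn generalizing w with
  | nil => obtain rfl : 1 = w := h.1; exact .one
  | append_singleton l k ih =>
    have hw : w = (l.map (simpleSwap n)).prod * simpleSwap n k := by simp [← h.1]
    have hl := card_inversions_le_length l
    have hc := h.length_eq
    simp only [List.length_append, List.length_cons, List.length_nil] at hc
    -- At a descent the product over `l` would have one inversion more than `w`, that is `l.length +
    -- 2`, exceeding the bound `l.length`.
    have hk : (l.map (simpleSwap n)).prod (lo k) < (l.map (simpleSwap n)).prod (hi k) := by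
      refine (lt_or_gt_lo_hi _ k).resolve_right fun hlt => ?_
      have := card_inversions_of_descent _ k hlt
      rw [← hw] at this
      omega
    have hr : IsReducedWord (l.map (simpleSwap n)).prod l := by
      refine ⟨rfl, fun l' hl' => ?_⟩
      have := h.2 (l' ++ [k]) (by simp [hl', hw])
      simpa using this
    simpa [← hw] using Lifts.step _ _ k hk (ih hr)

theorem reducedWord_lifts {n : ℕ} {R : Type*} [Monoid R] (f : Fin (n - 1) → R)
    (w : Equiv.Perm (Fin n)) : Lifts f w ((reducedWord w).map f).prod :=
  (exists_reducedWord w).choose_spec.lifts f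

section LiftOf

variable {n : ℕ} {R : Type*} [Monoid R] {f : Fin (n - 1) → R}

/-- The product of the `f i` along a reduced expression of `w`. -/
def liftOf (f : Fin (n - 1) → R) (w : Equiv.Perm (Fin n)) : R := ((reducedWord w).map f).prod

theorem liftOf_one (hf : BraidRelations f) : liftOf f 1 = 1 :=
  (reducedWord_lifts f 1).unique hf .one

theorem liftOf_mul_simpleSwap (hf : BraidRelations f) (w : Equiv.Perm (Fin n)) (k : Fin (n - 1))
    (hk : w (lo k) < w (hi k)) : liftOf f (w * simpleSwap n k) = liftOf f w * f k :=
  (reducedWord_lifts f _).unique hf (.step w _ k hk (reducedWord_lifts f w))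

end LiftOf

/-! ### The cycles moving one letter to the end -/

/-- The permutation sending `m` to `n - 1` and preserving the order of the other letters. -/
def cyc (n m : ℕ) : Equiv.Perm (Fin n) where
  toFun k := ⟨if (k : ℕ) < m then k else if (k : ℕ) = m then n - 1 else k - 1, by
    split_ifs <;> omega⟩
  invFun k := ⟨if (k : ℕ) < m then k else if (k : ℕ) = n - 1 then m else k + 1, by
    split_ifs <;> omega⟩
  left_inv k := by ext; simp only; split_ifs <;> omega
  right_inv k := by ext; simp only; split_ifs <;> omega

theorem cyc_val (n m : ℕ) (k : Fin n) : (cyc n m k : ℕ) =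
    if (k : ℕ) < m then (k : ℕ) else if (k : ℕ) = m then n - 1 else k - 1 := rfl

theorem cyc_eq_one (n m : ℕ) (h : n ≤ m + 1) : cyc n m = 1 := by
  ext k
  simp only [cyc_val, Equiv.Perm.one_apply]
  split_ifs <;> omega

theorem cyc_eq_mul (n : ℕ) (k : Fin (n - 1)) : cyc n k = cyc n (k + 1) * simpleSwap n k := by
  ext a
  simp only [Equiv.Perm.mul_apply, cyc_val, simpleSwap_val]
  split_ifs <;> omega

theorem chi_one (j : ℕ) : chi 1 j = cyc (1 + j) 0 := by
  ext a
  simp only [chi, Equiv.trans_apply, cyc_val, finCongr_apply, Fin.val_cast]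
  refine Fin.addCases (fun a => ?_) (fun a => ?_) a
  · simp
  · simp

/-- The position `k + 1` carries the largest value: the cycle sends it to the end, and `u` fixes the
end. -/
theorem cyc_ascent {n : ℕ} (u : Equiv.Perm (Fin n))
    (hu : ∀ a : Fin n, (a : ℕ) + 1 = n → (u a : ℕ) + 1 = n) (k : Fin (n - 1)) :
    (u * cyc n (k + 1)) (lo k) < (u * cyc n (k + 1)) (hi k) := by
  have h1 : ((u * cyc n (k + 1)) (hi k) : ℕ) + 1 = n := by
    refine hu _ ?_
    simp only [cyc_val, hi_val]
    split_ifs <;> omega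
  refine lt_of_le_of_ne (Fin.le_def.2 (by omega)) fun h => lo_ne_hi k (Equiv.injective _ h)

theorem liftOf_cyc {n : ℕ} {R : Type*} [Monoid R] {f : Fin (n - 1) → R} (hf : BraidRelations f)
    (k : Fin (n - 1)) : liftOf f (cyc n k) = liftOf f (cyc n (k + 1)) * f k := by
  rw [cyc_eq_mul, liftOf_mul_simpleSwap hf]
  simpa using cyc_ascent 1 (fun a h => h) k

/-- Lengths add in `u * cyc n m`: writing the cycle as a product of simple transpositions, each
factor is attached at an ascent both with and without `u` in front (`cyc_ascent`). The induction
increases `m` until the cycle becomes trivial. -/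
theorem liftOf_mul_cyc {n : ℕ} {R : Type*} [Monoid R] {f : Fin (n - 1) → R}
    (hf : BraidRelations f) (u : Equiv.Perm (Fin n))
    (hu : ∀ a : Fin n, (a : ℕ) + 1 = n → (u a : ℕ) + 1 = n) (m : ℕ) :
    liftOf f (u * cyc n m) = liftOf f u * liftOf f (cyc n m) := by
  by_cases hm : n ≤ m + 1
  · rw [cyc_eq_one n m hm, mul_one, liftOf_one hf, mul_one]
  · have ih := liftOf_mul_cyc hf u hu (m + 1)
    have h1 := liftOf_cyc hf ⟨m, by omega⟩
    have h2 := liftOf_mul_simpleSwap hf _ _ (cyc_ascent u hu ⟨m, by omega⟩)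
    rw [mul_assoc, ← cyc_eq_mul] at h2
    simp only at h1 h2
    rw [h1, h2, ih, mul_assoc]
termination_by n - m

/-! ### Extension of permutations by a fixed last letter -/

/-- The extension of a permutation by a fixed last letter. -/
def emb {n : ℕ} (w : Equiv.Perm (Fin n)) : Equiv.Perm (Fin (n + 1)) :=
  finSuccEquivLast.symm.permCongr (Equiv.optionCongr w)

@[simp] theorem emb_castSucc {n : ℕ} (w : Equiv.Perm (Fin n)) (a : Fin n) :
    emb w a.castSucc = (w a).castSucc := by
  simp [emb, Equiv.permCongr_apply]

@[simp] theorem emb_last {n : ℕ} (w : Equiv.Perm (Fin n)) : emb w (Fin.last n) = Fin.last n := by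
  simp [emb, Equiv.permCongr_apply]

theorem emb_one {n : ℕ} : emb (1 : Equiv.Perm (Fin n)) = 1 := by
  ext a
  refine Fin.lastCases (by simp) (fun a => by simp) a

theorem emb_injective {n : ℕ} : Function.Injective (emb (n := n)) := by
  intro u w h
  ext a
  have := DFunLike.congr_fun h a.castSucc
  simpa [Fin.ext_iff] using this

theorem emb_mul_simpleSwap {n : ℕ} (w : Equiv.Perm (Fin n)) (k : Fin (n - 1)) :
    emb (w * simpleSwap n k) = emb w * simpleSwap (n + 1) ⟨k, by omega⟩ := by
  ext a
  refine Fin.lastCases ?_ (fun a => ?_) a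
  · rw [emb_last, Equiv.Perm.mul_apply, simpleSwap_of_ne _ _ (by simp; omega) (by simp; omega),
      emb_last]
  · have : simpleSwap (n + 1) ⟨k, by omega⟩ a.castSucc = (simpleSwap n k a).castSucc := by
      ext
      simp only [simpleSwap_val, Fin.val_castSucc]
    rw [emb_castSucc, Equiv.Perm.mul_apply, Equiv.Perm.mul_apply, this, emb_castSucc]

theorem emb_ascent {n : ℕ} (w : Equiv.Perm (Fin n)) (k : Fin (n - 1)) (h : w (lo k) < w (hi k)) :
    emb w (lo ⟨k, by omega⟩) < emb w (hi ⟨k, by omega⟩) := by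
  have h1 : (lo ⟨k, by omega⟩ : Fin (n + 1)) = (lo k).castSucc := rfl
  have h2 : (hi ⟨k, by omega⟩ : Fin (n + 1)) = (hi k).castSucc := rfl
  rw [h1, h2, emb_castSucc, emb_castSucc]
  exact h

theorem exists_emb_eq {n : ℕ} (w : Equiv.Perm (Fin (n + 1))) (h : w (Fin.last n) = Fin.last n) :
    ∃ u, emb u = w := by
  have h0 : ∀ a : Fin n, w a.castSucc ≠ Fin.last n := fun a ha =>
    (Fin.castSucc_lt_last a).ne (w.injective (ha.trans h.symm))
  have hi : Function.Injective fun a : Fin n => (w a.castSucc).castPred (h0 a) := by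
    intro a b hab
    simpa using hab
  refine ⟨Equiv.ofBijective _ (Finite.injective_iff_bijective.1 hi), ?_⟩
  ext a
  refine Fin.lastCases ?_ (fun a => ?_) a
  · simp [h]
  · simp

/-! ### Shuffles -/

open Classical in
/-- The permutations of `n` letters which are increasing on the first `i` letters and on the
others. -/
def shuf (n i : ℕ) : Finset (Equiv.Perm (Fin n)) :=
  Finset.univ.filter fun w => ∀ a b : Fin n, a < b → ((b : ℕ) < i ∨ i ≤ a) → w a < w b

theorem mem_shuf {n i : ℕ} {w : Equiv.Perm (Fin n)} :
    w ∈ shuf n i ↔ ∀ a b : Fin n, a < b → ((b : ℕ) < i ∨ i ≤ a) → w a < w b := by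
  simp [shuf]

/-- In `shuf` the number of letters is a free parameter instead of a sum `i + j`, so that the
recursion on the last letter requires no transport between types. -/
theorem shuffles_eq_shuf (i j : ℕ) : shuffles i j = shuf (i + j) i := by
  classical
  ext w
  rw [mem_shuf]
  simp only [shuffles, Finset.mem_filter, Finset.mem_univ, true_and]
  constructor
  · rintro ⟨h1, h2⟩ a b hab h
    induction a using Fin.addCases with
    | left a =>
      induction b using Fin.addCases with
      | left b => exact h1 (show a < b from hab)
      | right b => simp at h; omega
    | right a =>
      induction b using Fin.addCases with
      | left b => simp [Fin.lt_def] at hab; omega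
      | right b => exact h2 (by simpa using hab)
  · intro h
    exact ⟨fun a b hab => h (Fin.castAdd j a) (Fin.castAdd j b) hab (.inl (by simp)),
      fun a b hab => h _ _ (by simpa using hab) (.inr (by simp))⟩

theorem emb_mem_shuf {n i : ℕ} (w : Equiv.Perm (Fin n)) :
    emb w ∈ shuf (n + 1) i ↔ w ∈ shuf n i := by
  rw [mem_shuf, mem_shuf]
  constructor
  · intro h a b hab hi
    have := h a.castSucc b.castSucc hab hi
    rwa [emb_castSucc, emb_castSucc] at this
  · intro h a b hab hi
    induction a using Fin.lastCases with
    | last => exact absurd hab (Fin.le_last b).not_gt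
    | cast a =>
      induction b using Fin.lastCases with
      | last => rw [emb_castSucc, emb_last]; exact Fin.castSucc_lt_last _
      | cast b => rw [emb_castSucc, emb_castSucc]; exact h a b hab hi

/-- The cycle moves the end of the first block to the last position and preserves the order of the
other letters, which therefore form blocks of `i` and `n - i` letters. -/
theorem emb_mul_cyc_mem_shuf {n i : ℕ} (hi : i ≤ n) (w : Equiv.Perm (Fin n)) :
    emb w * cyc (n + 1) i ∈ shuf (n + 1) (i + 1) ↔ w ∈ shuf n i := by
  rw [← emb_mem_shuf w, mem_shuf, mem_shuf]
  have hlast : ∀ a : Fin (n + 1), a ≠ Fin.last n → emb w a < Fin.last n := fun a ha =>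
    Fin.lt_last_iff_ne_last.2 fun h => ha ((emb w).injective (h.trans (emb_last w).symm))
  constructor
  · intro h a b hab hi'
    by_cases hb : b = Fin.last n
    · subst hb; rw [emb_last]; exact hlast a hab.ne
    have hb' : (b : ℕ) < n := Fin.val_lt_last hb
    have hab' : (a : ℕ) < b := hab
    obtain ⟨a', rfl⟩ := (cyc (n + 1) i).surjective a
    obtain ⟨b', rfl⟩ := (cyc (n + 1) i).surjective b
    have e1 := cyc_val (n + 1) i a'
    have e2 := cyc_val (n + 1) i b'
    refine h a' b' ?_ ?_
    · rw [Fin.lt_def]; split_ifs at e1 e2 <;> omega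
    · split_ifs at e1 e2 <;> omega
  · intro h a b hab hi'
    have hab' : (a : ℕ) < b := hab
    have e1 := cyc_val (n + 1) i a
    have e2 := cyc_val (n + 1) i b
    by_cases hb : (b : ℕ) = i
    · have hb1 : cyc (n + 1) i b = Fin.last n := by
        ext; simp [e2, hb]
      rw [Equiv.Perm.mul_apply, Equiv.Perm.mul_apply, hb1, emb_last]
      exact hlast _ fun h' => hab.ne ((cyc (n + 1) i).injective (h'.trans hb1.symm))
    · refine h _ _ ?_ ?_
      · rw [Fin.lt_def]; split_ifs at e1 e2 <;> omega
      · split_ifs at e1 e2 <;> omega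

/-- Within a block values increase, so a letter with a successor in its block cannot have the
largest value. -/
theorem shuf_last {n i : ℕ} {w : Equiv.Perm (Fin (n + 1))} (hw : w ∈ shuf (n + 1) i)
    (a : Fin (n + 1)) (ha : w a = Fin.last n) : a = Fin.last n ∨ (a : ℕ) + 1 = i := by
  rw [mem_shuf] at hw
  by_contra! h
  have han : (a : ℕ) < n := Fin.val_lt_last h.1
  have := hw a ⟨a + 1, by omega⟩ (Nat.lt_succ_self _) (by simp only; omega)
  rw [ha] at this
  exact absurd this (Fin.le_last _).not_gt

theorem sum_shuf_last {X : Type*} [AddCommMonoid X] {n i : ℕ}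
    (F : Equiv.Perm (Fin (n + 1)) → X) :
    ∑ w ∈ shuf (n + 1) i with w (Fin.last n) = Fin.last n, F w = ∑ w ∈ shuf n i, F (emb w) := by
  symm
  refine Finset.sum_nbij emb (fun w hw => ?_) emb_injective.injOn (fun w hw => ?_)
    fun _ _ => rfl
  · simpa [emb_mem_shuf] using hw
  · simp only [Finset.coe_filter, Set.mem_ofPred_eq] at hw
    obtain ⟨u, rfl⟩ := exists_emb_eq w hw.2
    exact ⟨u, (emb_mem_shuf u).1 hw.1, rfl⟩

theorem sum_shuf_cyc {X : Type*} [AddCommMonoid X] {n i : ℕ} (hi : i ≤ n)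
    (F : Equiv.Perm (Fin (n + 1)) → X) :
    ∑ w ∈ shuf (n + 1) (i + 1) with w ⟨i, by omega⟩ = Fin.last n, F w =
      ∑ w ∈ shuf n i, F (emb w * cyc (n + 1) i) := by
  have hc : cyc (n + 1) i ⟨i, by omega⟩ = Fin.last n := by ext; simp [cyc_val]
  symm
  refine Finset.sum_nbij (fun w => emb w * cyc (n + 1) i) (fun w hw => ?_)
    (((mul_left_injective _).comp emb_injective).injOn) (fun w hw => ?_) fun _ _ => rfl
  · simpa [emb_mul_cyc_mem_shuf hi, hc] using hw
  · simp only [Finset.coe_filter, Set.mem_ofPred_eq] at hw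
    obtain ⟨u, hu⟩ := exists_emb_eq (w * (cyc (n + 1) i)⁻¹) (by
      rw [← hc, Equiv.Perm.mul_apply, inv_apply_cancel, hc, hw.2])
    have hu' : emb u * cyc (n + 1) i = w := by rw [hu, inv_mul_cancel_right]
    exact ⟨u, (emb_mul_cyc_mem_shuf hi u).1 (hu' ▸ hw.1), hu'⟩

theorem sum_shuf_zero {X : Type*} [AddCommMonoid X] (n : ℕ) (F : Equiv.Perm (Fin (n + 1)) → X) :
    ∑ w ∈ shuf (n + 1) 0, F w = ∑ w ∈ shuf n 0, F (emb w) := by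
  rw [← sum_shuf_last, Finset.filter_true_of_mem]
  intro w hw
  obtain ⟨a, ha⟩ := w.surjective (Fin.last n)
  rcases shuf_last hw a ha with rfl | h
  · exact ha
  · omega

/-- Here the second block is empty and `cyc (n + 1) n` is the identity. It is kept so that the
formula has the shape of the general recursion. -/
theorem sum_shuf_self {X : Type*} [AddCommMonoid X] (n : ℕ) (F : Equiv.Perm (Fin (n + 1)) → X) :
    ∑ w ∈ shuf (n + 1) (n + 1), F w = ∑ w ∈ shuf n n, F (emb w * cyc (n + 1) n) := by
  rw [← sum_shuf_cyc le_rfl, Finset.filter_true_of_mem]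
  intro w hw
  obtain ⟨a, ha⟩ := w.surjective (Fin.last n)
  rcases shuf_last hw a ha with rfl | h
  · exact ha
  · convert ha
    omega

/-- The bound `i + 1 ≤ n` says that the second block is nonempty. The two possible letters sent to
the last position are then distinct, so the two classes of shuffles are disjoint. -/
theorem sum_shuf_succ {X : Type*} [AddCommMonoid X] {n i : ℕ} (hi : i + 1 ≤ n)
    (F : Equiv.Perm (Fin (n + 1)) → X) :
    ∑ w ∈ shuf (n + 1) (i + 1), F w =
      ∑ w ∈ shuf n (i + 1), F (emb w) + ∑ w ∈ shuf n i, F (emb w * cyc (n + 1) i) := by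
  rw [← sum_shuf_last, ← sum_shuf_cyc (by omega),
    ← Finset.sum_filter_add_sum_filter_not (shuf (n + 1) (i + 1))
      (fun w => w (Fin.last n) = Fin.last n)]
  congr 2
  refine Finset.filter_congr fun w hw => ?_
  constructor
  · intro h
    obtain ⟨a, ha⟩ := w.surjective (Fin.last n)
    rcases shuf_last hw a ha with rfl | h'
    · exact absurd ha h
    · convert ha
      omega
  · intro h h'
    have := w.injective (h.trans h'.symm)
    simp [Fin.ext_iff] at this
    omega

section Tensor

variable {K V : Type*} [Field K] [AddCommGroup V] [Module K V]

/-! ### Products of tensors -/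

theorem mulEquiv_tprod {a b : ℕ} (u : Fin a → V) (v : Fin b → V) :
    TensorPower.mulEquiv (R := K) (M := V)
      (PiTensorProduct.tprod K u ⊗ₜ PiTensorProduct.tprod K v) =
        PiTensorProduct.tprod K (Fin.append u v) := by
  have h := TensorPower.tprod_mul_tprod K u v
  rwa [TensorPower.gMul_def] at h

theorem mulEquiv_symm_tprod {a b : ℕ} (u : Fin (a + b) → V) :
    (TensorPower.mulEquiv (R := K) (M := V)).symm (PiTensorProduct.tprod K u) =
      PiTensorProduct.tprod K (fun k => u (Fin.castAdd b k)) ⊗ₜ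
        PiTensorProduct.tprod K (fun k => u (Fin.natAdd a k)) := by
  rw [LinearEquiv.symm_apply_eq, mulEquiv_tprod]
  congr 1
  funext k
  refine Fin.addCases (fun k => ?_) (fun k => ?_) k <;> simp

theorem powOne_symm {A : Type*} [AddCommMonoid A] [Module K A] (v : A) :
    (powOne : ⨂[K]^1 A ≃ₗ[K] A).symm v = PiTensorProduct.tprod K fun _ => v := by
  rw [powOne, PiTensorProduct.subsingletonEquiv_symm_apply']

theorem powOne_tprod (v : Fin 1 → V) : powOne (PiTensorProduct.tprod K v) = v 0 := by
  rw [powOne, PiTensorProduct.subsingletonEquiv_apply_tprod]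

/-- The product `V^{⊗a} × V^{⊗b} → V^{⊗n}` for `n = a + b`. -/
def mulTo {a b n : ℕ} (h : a + b = n) : ⨂[K]^a V →ₗ[K] ⨂[K]^b V →ₗ[K] ⨂[K]^n V :=
  (TensorProduct.mk K _ _).compr₂
    (TensorPower.mulEquiv (R := K) (M := V) ≪≫ₗ TensorPower.cast K V h).toLinearMap

theorem mulTo_apply {a b n : ℕ} (h : a + b = n) (x : ⨂[K]^a V) (y : ⨂[K]^b V) :
    mulTo h x y = TensorPower.cast K V h (TensorPower.mulEquiv (R := K) (M := V) (x ⊗ₜ y)) := rfl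

theorem mulTo_rfl {a b : ℕ} (x : ⨂[K]^a V) (y : ⨂[K]^b V) :
    mulTo rfl x y = TensorPower.mulEquiv (R := K) (M := V) (x ⊗ₜ y) := by
  rw [mulTo_apply, TensorPower.cast_refl, LinearEquiv.refl_apply]

theorem mulTo_tprod {a b n : ℕ} (h : a + b = n) (u : Fin a → V) (v : Fin b → V) :
    mulTo h (PiTensorProduct.tprod K u) (PiTensorProduct.tprod K v) =
      PiTensorProduct.tprod K fun k => Fin.append u v (Fin.cast h.symm k) := by
  rw [mulTo_apply, mulEquiv_tprod, TensorPower.cast_tprod]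
  rfl

theorem mulTo_eq_tprod {a b n : ℕ} (h : a + b = n) (w : Fin n → V) :
    mulTo h (PiTensorProduct.tprod K fun k : Fin a => w ⟨k, by omega⟩)
      (PiTensorProduct.tprod K fun k : Fin b => w ⟨a + k, by omega⟩) =
        PiTensorProduct.tprod K w := by
  subst h
  rw [mulTo_tprod]
  congr 1
  funext k
  refine Fin.addCases (fun k => ?_) (fun k => ?_) k <;> simp <;> rfl

/-- Bilinear maps on tensor powers are determined by their values on pure tensors. -/
theorem ext_tprod₂ {a b : ℕ} {W : Type*} [AddCommMonoid W] [Module K W]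
    {f g : ⨂[K]^a V →ₗ[K] ⨂[K]^b V →ₗ[K] W}
    (h : ∀ u v, f (PiTensorProduct.tprod K u) (PiTensorProduct.tprod K v) =
      g (PiTensorProduct.tprod K u) (PiTensorProduct.tprod K v)) : f = g :=
  PiTensorProduct.ext <| MultilinearMap.ext fun u =>
    PiTensorProduct.ext <| MultilinearMap.ext fun v => h u v

/-- With the degrees given by arbitrary equations, associativity holds without explicit casts. -/
theorem mulTo_assoc {a b c m l n : ℕ} (h₁ : a + b = m) (h₂ : m + c = n) (h₃ : b + c = l)
    (h₄ : a + l = n) (x : ⨂[K]^a V) (y : ⨂[K]^b V) (z : ⨂[K]^c V) :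
    mulTo h₂ (mulTo h₁ x y) z = mulTo h₄ x (mulTo h₃ y z) := by
  induction x using PiTensorProduct.induction_on with
  | add x x' hx hx' => simp only [map_add, LinearMap.add_apply, hx, hx']
  | smul_tprod r u =>
    simp only [map_smul, LinearMap.smul_apply]
    congr 1
    revert y z
    suffices h : (mulTo h₂).comp (mulTo h₁ (PiTensorProduct.tprod K u)) =
        (mulTo (K := K) (V := V) h₃).compr₂ (mulTo h₄ (PiTensorProduct.tprod K u)) from
      fun y z => LinearMap.congr_fun₂ h y z
    refine ext_tprod₂ fun v w => ?_
    simp only [LinearMap.comp_apply, LinearMap.compr₂_apply, mulTo_tprod]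
    congr 1
    funext k
    subst h₁ h₃ h₂
    have e := congrArg (fun f => f k) (Fin.append_assoc u v w)
    simp only [Fin.cast_refl, Function.comp_apply, id_eq] at e ⊢
    exact e

theorem mulTo_cast {a b b' n : ℕ} (e : b = b') (h : a + b' = n) (x : ⨂[K]^a V) (y : ⨂[K]^b V) :
    mulTo h x (TensorPower.cast K V e y) = mulTo (e ▸ h) x y := by
  subst e
  rw [TensorPower.cast_refl, LinearEquiv.refl_apply]

/-! ### The operators `sigmaAt` on pure tensors -/

/-- The tensors obtained from `v` by changing the letters at the positions `p` and `q`. -/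
def ins {n : ℕ} (v : Fin n → V) (p q : Fin n) (hpq : p ≠ q) : V ⊗[K] V →ₗ[K] ⨂[K]^n V :=
  TensorProduct.lift <| LinearMap.mk₂ K
    (fun a b => PiTensorProduct.tprod K (Function.update (Function.update v p a) q b))
    (fun a a' b => by
      simp only [Function.update_comm hpq, MultilinearMap.map_update_add])
    (fun c a b => by
      simp only [Function.update_comm hpq, MultilinearMap.map_update_smul])
    (fun a b b' => by simp only [MultilinearMap.map_update_add])
    (fun c a b => by simp only [MultilinearMap.map_update_smul])

@[simp] theorem ins_tmul {n : ℕ} (v : Fin n → V) (p q : Fin n) (hpq : p ≠ q) (a b : V) :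
    ins (K := K) v p q hpq (a ⊗ₜ b) =
      PiTensorProduct.tprod K (Function.update (Function.update v p a) q b) := rfl

theorem ins_self {n : ℕ} (v : Fin n → V) (p q : Fin n) (hpq : p ≠ q) :
    ins (K := K) v p q hpq (v p ⊗ₜ v q) = PiTensorProduct.tprod K v := by
  simp

theorem splitAt_tprod {n : ℕ} (v : Fin n → V) (i : Fin (n - 1)) :
    splitAt i (PiTensorProduct.tprod K v) =
      PiTensorProduct.tprod K (fun k : Fin i => v ⟨k, by omega⟩) ⊗ₜ
        ((v (lo i) ⊗ₜ v (hi i)) ⊗ₜ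
          PiTensorProduct.tprod K (fun k : Fin (n - 2 - i) => v ⟨i + (2 + k), by omega⟩)) := by
  simp only [splitAt, LinearEquiv.trans_apply, TensorPower.cast_tprod, mulEquiv_symm_tprod,
    TensorProduct.congr_tmul, LinearEquiv.refl_apply, powOne_tprod]
  rfl

theorem splitAt_ins {n : ℕ} (v : Fin n → V) (i : Fin (n - 1)) (t : V ⊗[K] V) :
    splitAt i (ins v (lo i) (hi i) (lo_ne_hi i) t) =
      PiTensorProduct.tprod K (fun k : Fin i => v ⟨k, by omega⟩) ⊗ₜ
        (t ⊗ₜ PiTensorProduct.tprod K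
          (fun k : Fin (n - 2 - i) => v ⟨i + (2 + k), by omega⟩)) := by
  induction t with
  | zero => simp
  | add x y hx hy => simp only [map_add, hx, hy, TensorProduct.add_tmul, TensorProduct.tmul_add]
  | tmul a b =>
    rw [ins_tmul, splitAt_tprod]
    congr 2
    · funext k
      rw [Function.update_of_ne, Function.update_of_ne] <;>
        simp only [ne_eq, Fin.ext_iff, lo_val, hi_val] <;> omega
    · simp [lo_ne_hi]
    · congr 1
      funext k
      rw [Function.update_of_ne, Function.update_of_ne] <;>
        simp only [ne_eq, Fin.ext_iff, lo_val, hi_val] <;> omega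

variable (s : V ⊗[K] V →ₗ[K] V ⊗[K] V)

/-- Since `s` applied to a pure tensor need not be pure, `ins` records two letters as an arbitrary
element of $V\otimes V$. Identities for the operators on tensor powers thus reduce to identities for
`s`. -/
theorem sigmaAt_ins {n : ℕ} (v : Fin n → V) (i : Fin (n - 1)) (t : V ⊗[K] V) :
    sigmaAt s i (ins v (lo i) (hi i) (lo_ne_hi i) t) =
      ins v (lo i) (hi i) (lo_ne_hi i) (s t) := by
  simp only [sigmaAt, LinearMap.comp_apply, LinearEquiv.coe_coe, LinearEquiv.symm_apply_eq,
    splitAt_ins, LinearMap.lTensor_tmul, LinearMap.rTensor_tmul]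

theorem sigmaAt_tprod {n : ℕ} (v : Fin n → V) (i : Fin (n - 1)) :
    sigmaAt s i (PiTensorProduct.tprod K v) =
      ins v (lo i) (hi i) (lo_ne_hi i) (s (v (lo i) ⊗ₜ v (hi i))) := by
  rw [← sigmaAt_ins, ins_self]

theorem sigmaAt_mulTo_left {a b n : ℕ} (h : a + b = n) (k : Fin (a - 1)) (k' : Fin (n - 1))
    (hk : (k' : ℕ) = k) (x : ⨂[K]^a V) (y : ⨂[K]^b V) :
    sigmaAt s k' (mulTo h x y) = mulTo h (sigmaAt s k x) y := by
  subst h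
  suffices h : (mulTo rfl).compr₂ (sigmaAt s k') = (mulTo rfl).comp (sigmaAt s k) from
    LinearMap.congr_fun₂ h x y
  refine ext_tprod₂ fun u v => ?_
  simp only [LinearMap.comp_apply, LinearMap.compr₂_apply, mulTo_tprod, sigmaAt_tprod]
  have e1 : lo k' = Fin.castAdd b (lo k) := Fin.ext (by simp [hk])
  have e2 : hi k' = Fin.castAdd b (hi k) := Fin.ext (by simp [hk])
  simp only [Fin.cast_refl, id_eq, e1, e2, Fin.append_left]
  induction s (u (lo k) ⊗ₜ u (hi k)) with
  | zero => simp
  | add x y hx hy => simp only [map_add, hx, hy, LinearMap.add_apply]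
  | tmul x y =>
    simp only [ins_tmul, mulTo_tprod]
    congr 1
    funext l
    refine Fin.addCases (fun l => ?_) (fun l => ?_) l
    · simp [Function.update_apply, Fin.ext_iff]
    · simp only [Function.update_apply, Fin.ext_iff, Fin.val_natAdd, Fin.val_castAdd, lo_val,
        hi_val, Fin.cast_refl, id_eq, Fin.append_right]
      rw [if_neg (by omega), if_neg (by omega)]

theorem sigmaAt_mulTo_right {a b n : ℕ} (h : a + b = n) (k : Fin (b - 1)) (k' : Fin (n - 1))
    (hk : (k' : ℕ) = a + k) (x : ⨂[K]^a V) (y : ⨂[K]^b V) :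
    sigmaAt s k' (mulTo h x y) = mulTo h x (sigmaAt s k y) := by
  subst h
  suffices h : (mulTo rfl).compr₂ (sigmaAt s k') = (mulTo rfl).compl₂ (sigmaAt s k) from
    LinearMap.congr_fun₂ h x y
  refine ext_tprod₂ fun u v => ?_
  simp only [LinearMap.compl₂_apply, LinearMap.compr₂_apply, mulTo_tprod, sigmaAt_tprod]
  have e1 : lo k' = Fin.natAdd a (lo k) := Fin.ext (by simp [hk])
  have e2 : hi k' = Fin.natAdd a (hi k) := Fin.ext (by simp [hk]; omega)
  simp only [Fin.cast_refl, id_eq, e1, e2, Fin.append_right]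
  induction s (v (lo k) ⊗ₜ v (hi k)) with
  | zero => simp
  | add x y hx hy => simp only [map_add, hx, hy]
  | tmul x y =>
    simp only [ins_tmul, mulTo_tprod]
    congr 1
    funext l
    refine Fin.addCases (fun l => ?_) (fun l => ?_) l
    · simp only [Function.update_apply, Fin.ext_iff, Fin.val_natAdd, Fin.val_castAdd, lo_val,
        hi_val, Fin.cast_refl, id_eq, Fin.append_left]
      rw [if_neg (by omega), if_neg (by omega)]
    · simp [Function.update_apply, Fin.ext_iff]

/-- The tensors obtained from `v` by changing three letters. -/
def ins₃ {n : ℕ} (v : Fin n → V) (p q r : Fin n) (hpq : p ≠ q) (hpr : p ≠ r) (hqr : q ≠ r) :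
    (V ⊗[K] V) ⊗[K] V →ₗ[K] ⨂[K]^n V :=
  TensorProduct.lift <| TensorProduct.lift <| LinearMap.mk₂ K
    (fun a b => (PiTensorProduct.tprod K).toLinearMap
      (Function.update (Function.update v p a) q b) r)
    (fun a a' b => by
      ext c
      simp only [MultilinearMap.toLinearMap_apply, LinearMap.add_apply,
        Function.update_comm hpq, Function.update_comm hpr, MultilinearMap.map_update_add])
    (fun c a b => by
      ext c
      simp only [MultilinearMap.toLinearMap_apply, LinearMap.smul_apply,
        Function.update_comm hpq, Function.update_comm hpr, MultilinearMap.map_update_smul])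
    (fun a b b' => by
      ext c
      simp only [MultilinearMap.toLinearMap_apply, LinearMap.add_apply,
        Function.update_comm hqr, MultilinearMap.map_update_add])
    (fun c a b => by
      ext c
      simp only [MultilinearMap.toLinearMap_apply, LinearMap.smul_apply,
        Function.update_comm hqr, MultilinearMap.map_update_smul])

@[simp] theorem ins₃_tmul {n : ℕ} (v : Fin n → V) (p q r : Fin n) (hpq : p ≠ q) (hpr : p ≠ r)
    (hqr : q ≠ r) (t : V ⊗[K] V) (c : V) :
    ins₃ (K := K) v p q r hpq hpr hqr (t ⊗ₜ c) = ins (Function.update v r c) p q hpq t := by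
  induction t with
  | zero => simp
  | add x y hx hy => simp only [map_add, TensorProduct.add_tmul, hx, hy]
  | tmul a b =>
    simp only [ins₃, TensorProduct.lift.tmul, LinearMap.mk₂_apply,
      MultilinearMap.toLinearMap_apply, ins_tmul]
    rw [Function.update_comm hqr, Function.update_comm hpr]

theorem ins₃_assoc {n : ℕ} (v : Fin n → V) (p q r : Fin n) (hpq : p ≠ q) (hpr : p ≠ r)
    (hqr : q ≠ r) (a : V) (t : V ⊗[K] V) :
    ins₃ (K := K) v p q r hpq hpr hqr ((TensorProduct.assoc K V V V).symm (a ⊗ₜ t)) =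
      ins (Function.update v p a) q r hqr t := by
  induction t with
  | zero => simp
  | add x y hx hy => simp only [map_add, TensorProduct.tmul_add, hx, hy]
  | tmul b c =>
    simp only [TensorProduct.assoc_symm_tmul, ins₃_tmul, ins_tmul]
    rw [Function.update_comm hpr.symm, Function.update_comm hqr.symm]

/-- On three neighbouring letters, inserted by `ins₃`, the two operators act as
$s\otimes\mathrm{id}$ and $\mathrm{id}\otimes s$, so the relation becomes the Yang–Baxter equation.
-/
theorem sigmaAt_braid (hs : YangBaxter s) {n : ℕ} (k m : Fin (n - 1)) (h : (k : ℕ) + 1 = m) :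
    sigmaAt s k * sigmaAt s m * sigmaAt s k = sigmaAt s m * sigmaAt s k * sigmaAt s m := by
  refine PiTensorProduct.ext <| MultilinearMap.ext fun v => ?_
  have hpq : lo k ≠ lo m := by simp only [ne_eq, Fin.ext_iff, lo_val]; omega
  have hpr : lo k ≠ hi m := by simp only [ne_eq, Fin.ext_iff, lo_val, hi_val]; omega
  have hqr : lo m ≠ hi m := lo_ne_hi m
  have e : hi k = lo m := Fin.ext h
  have h1 : ∀ t, sigmaAt s k (ins₃ v _ _ _ hpq hpr hqr t) =
      ins₃ v _ _ _ hpq hpr hqr (s.rTensor V t) := by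
    intro t
    induction t with
    | zero => simp
    | add x y hx hy => simp only [map_add, hx, hy]
    | tmul t c =>
      rw [ins₃_tmul, LinearMap.rTensor_tmul, ins₃_tmul]
      simp only [← e]
      exact sigmaAt_ins s _ k t
  have h2 : ∀ t, sigmaAt s m (ins₃ v _ _ _ hpq hpr hqr t) =
      ins₃ v _ _ _ hpq hpr hqr (((TensorProduct.assoc K V V V).symm.toLinearMap ∘ₗ s.lTensor V ∘ₗ
      (TensorProduct.assoc K V V V).toLinearMap) t) := by
    intro t
    obtain ⟨t, rfl⟩ := (TensorProduct.assoc K V V V).symm.surjective t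
    simp only [LinearMap.comp_apply, LinearEquiv.coe_coe, LinearEquiv.apply_symm_apply]
    induction t with
    | zero => simp
    | add x y hx hy => simp only [map_add, hx, hy]
    | tmul a t =>
      rw [ins₃_assoc, LinearMap.lTensor_tmul, ins₃_assoc]
      exact sigmaAt_ins s _ m t
  have h3 : PiTensorProduct.tprod K v =
      ins₃ v _ _ _ hpq hpr hqr ((v (lo k) ⊗ₜ v (lo m)) ⊗ₜ v (hi m)) := by
    simp
  simp only [LinearMap.compMultilinearMap_apply, Module.End.mul_apply]
  rw [h3, h1, h2, h1, h2, h1, h2]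
  exact congrArg _ (LinearMap.congr_fun hs _)

theorem sigmaAt_comm {n : ℕ} (k m : Fin (n - 1)) (h : (k : ℕ) + 1 < m) :
    sigmaAt s k * sigmaAt s m = sigmaAt s m * sigmaAt s k := by
  refine PiTensorProduct.ext <| MultilinearMap.ext fun v => ?_
  -- Cutting after `k + 2` letters separates the pairs of positions on which the two operators act.
  have hn : (k + 2 : ℕ) + (n - (k + 2)) = n := by omega
  simp only [LinearMap.compMultilinearMap_apply, Module.End.mul_apply]
  rw [← mulTo_eq_tprod hn v, sigmaAt_mulTo_right s hn ⟨m - (k + 2), by omega⟩ m (by simp; omega),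
    sigmaAt_mulTo_left s hn ⟨k, by omega⟩ k rfl, sigmaAt_mulTo_left s hn ⟨k, by omega⟩ k rfl,
    sigmaAt_mulTo_right s hn ⟨m - (k + 2), by omega⟩ m (by simp; omega)]

theorem braidRelations_sigmaAt (hs : YangBaxter s) (n : ℕ) :
    BraidRelations (sigmaAt s (n := n)) :=
  ⟨fun k m h => sigmaAt_comm s k m h, fun k m h => sigmaAt_braid s hs k m h⟩

end Tensor

section Recursion

variable {K V : Type*} [Field K] [AddCommGroup V] [Module K V]
variable (s : V ⊗[K] V →ₗ[K] V ⊗[K] V)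

/-! ### Recursion for the shuffle sums -/

theorem braidLift_one {n : ℕ} (hs : YangBaxter s) : braidLift s (1 : Equiv.Perm (Fin n)) = 1 :=
  liftOf_one (braidRelations_sigmaAt s hs n)

theorem braidLift_emb (hs : YangBaxter s) {n : ℕ} (w : Equiv.Perm (Fin n)) (x : ⨂[K]^n V)
    (y : ⨂[K]^1 V) : braidLift s (emb w) (mulTo rfl x y) = mulTo rfl (braidLift s w x) y := by
  induction w using ascent_induction generalizing x with
  | one => rw [emb_one, braidLift_one s hs, braidLift_one s hs]; rfl
  | step w k hk ih =>
    have h1 := liftOf_mul_simpleSwap (braidRelations_sigmaAt s hs n) w k hk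
    have h2 := liftOf_mul_simpleSwap (braidRelations_sigmaAt s hs (n + 1)) (emb w)
      ⟨k, by omega⟩ (emb_ascent w k hk)
    rw [← emb_mul_simpleSwap] at h2
    -- By definition `braidLift s` is `liftOf (sigmaAt s)`.
    change braidLift s _ = braidLift s _ * _ at h1 h2
    rw [h1, h2, Module.End.mul_apply, Module.End.mul_apply, ← ih]
    exact congrArg _ (sigmaAt_mulTo_left s rfl k _ rfl x y)

theorem braidLift_emb_mul_cyc (hs : YangBaxter s) {n : ℕ} (w : Equiv.Perm (Fin n)) (m : ℕ) :
    braidLift s (emb w * cyc (n + 1) m) = braidLift s (emb w) * braidLift s (cyc (n + 1) m) := by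
  refine liftOf_mul_cyc (braidRelations_sigmaAt s hs (n + 1)) (emb w) (fun a ha => ?_) m
  obtain rfl : a = Fin.last n := Fin.ext (by simpa using ha)
  simp

/-- The cycle moves only positions from `a + m` on. Its factors are operators on the last `b`
letters, with indices shifted by `a`. -/
theorem braidLift_cyc_mulTo (hs : YangBaxter s) {a b n : ℕ} (h : a + b = n) (m : ℕ)
    (x : ⨂[K]^a V) (y : ⨂[K]^b V) :
    braidLift s (cyc n (a + m)) (mulTo h x y) = mulTo h x (braidLift s (cyc b m) y) := by
  by_cases hm : b ≤ m + 1
  · rw [cyc_eq_one _ _ hm, cyc_eq_one _ _ (by omega), braidLift_one s hs, braidLift_one s hs]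
    rfl
  · have h1 := liftOf_cyc (braidRelations_sigmaAt s hs b) ⟨m, by omega⟩
    have h2 := liftOf_cyc (braidRelations_sigmaAt s hs n) ⟨a + m, by omega⟩
    change braidLift s _ = braidLift s _ * _ at h1 h2
    simp only at h1 h2
    rw [h1, h2, Module.End.mul_apply, Module.End.mul_apply,
      sigmaAt_mulTo_right s h ⟨m, by omega⟩ ⟨a + m, by omega⟩ rfl, add_assoc,
      braidLift_cyc_mulTo hs h (m + 1)]
termination_by b - m

/-- The sum of the lifts of the shuffles. -/
def shufSum (n i : ℕ) : Module.End K (⨂[K]^n V) := ∑ w ∈ shuf n i, braidLift s w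

theorem shufSum_one (hs : YangBaxter s) (i : ℕ) : shufSum s 1 i = 1 := by
  have : shuf 1 i = {1} := by
    ext w
    simp only [Finset.mem_singleton, Subsingleton.elim w 1, mem_shuf, iff_true]
    intro a b hab
    exact absurd hab (by rw [Subsingleton.elim a b]; exact lt_irrefl _)
  rw [shufSum, this, Finset.sum_singleton, braidLift_one s hs]

theorem shufSum_zero (hs : YangBaxter s) (i : ℕ) : shufSum s 0 i = 1 := by
  have : shuf 0 i = {1} := by
    ext w
    simp only [Finset.mem_singleton, Subsingleton.elim w 1, mem_shuf, iff_true]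
    exact fun a => a.elim0
  rw [shufSum, this, Finset.sum_singleton, braidLift_one s hs]

/-- The sum over the shuffles sending the letter `i` to the last position. -/
def cycSum (n i : ℕ) : Module.End K (⨂[K]^(n + 1) V) :=
  (∑ w ∈ shuf n i, braidLift s (emb w)) * braidLift s (cyc (n + 1) i)

/-- The product form of `cycSum` is the one that the coproduct yields: first the braiding of one
letter to the end, then the shuffles of the remaining letters. -/
theorem cycSum_eq (hs : YangBaxter s) (n i : ℕ) :
    cycSum s n i = ∑ w ∈ shuf n i, braidLift s (emb w * cyc (n + 1) i) := by
  simp only [cycSum, Finset.sum_mul, braidLift_emb_mul_cyc s hs]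

theorem sum_emb_mulTo (hs : YangBaxter s) {n i : ℕ} (x : ⨂[K]^n V) (y : ⨂[K]^1 V) :
    (∑ w ∈ shuf n i, braidLift s (emb w)) (mulTo rfl x y) = mulTo rfl (shufSum s n i x) y := by
  simp only [shufSum, LinearMap.sum_apply, braidLift_emb s hs, map_sum]

theorem shufSum_succ_zero (n : ℕ) :
    shufSum s (n + 1) 0 = ∑ w ∈ shuf n 0, braidLift s (emb w) := sum_shuf_zero n _

theorem shufSum_succ_self (hs : YangBaxter s) (n : ℕ) :
    shufSum s (n + 1) (n + 1) = cycSum s n n := by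
  rw [cycSum_eq s hs, shufSum, sum_shuf_self n]

theorem shufSum_succ_succ (hs : YangBaxter s) {n i : ℕ} (hi : i + 1 ≤ n) :
    shufSum s (n + 1) (i + 1) =
      ∑ w ∈ shuf n (i + 1), braidLift s (emb w) + cycSum s n i := by
  rw [cycSum_eq s hs, shufSum, sum_shuf_succ hi]

/-! ### Recursion for the powers of `M` -/

theorem incl_tprod_congr {m n : ℕ} (h : m = n) (v : Fin m → V) (w : Fin n → V)
    (hvw : ∀ k : Fin m, v k = w (Fin.cast h k)) :
    incl m (PiTensorProduct.tprod K v) = incl n (PiTensorProduct.tprod K w) := by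
  subst h
  congr 2
  exact funext hvw

theorem deconc_incl_tprod {n : ℕ} (v : Fin n → V) :
    deconc (incl n (PiTensorProduct.tprod K v)) = ∑ i : Fin (n + 1),
      incl i (PiTensorProduct.tprod K fun k : Fin i => v ⟨k, by omega⟩) ⊗ₜ
        incl (n - i) (PiTensorProduct.tprod K fun k : Fin (n - i) => v ⟨i + k, by omega⟩) := by
  simp only [deconc, incl, DirectSum.toModule_lof, LinearMap.sum_apply, LinearMap.comp_apply,
    LinearEquiv.coe_coe, TensorPower.cast_tprod, mulEquiv_symm_tprod, TensorProduct.map_tmul]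
  rfl

theorem chi_zero (j : ℕ) : chi 0 j = 1 := by
  ext a
  refine Fin.addCases (fun a => a.elim0) (fun a => ?_) a
  simp only [chi, Equiv.trans_apply, finAddFlip_apply_natAdd, finCongr_apply, Fin.val_cast,
    Fin.val_castAdd, Fin.val_natAdd, Equiv.Perm.one_apply, zero_add]

theorem betaHom_zero (hs : YangBaxter s) (j : ℕ) (u : Fin 0 → V) (v : Fin j → V) :
    betaHom s 0 j (PiTensorProduct.tprod K u ⊗ₜ PiTensorProduct.tprod K v) =
      PiTensorProduct.tprod K v ⊗ₜ PiTensorProduct.tprod K u := by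
  simp only [betaHom, LinearMap.comp_apply, LinearEquiv.coe_coe, chi_zero, braidLift_one s hs,
    Module.End.one_apply, mulEquiv_tprod, TensorPower.cast_tprod, mulEquiv_symm_tprod]
  congr 2
  · funext k
    have : Fin.cast (Nat.add_comm 0 j).symm (Fin.castAdd 0 k) = Fin.natAdd 0 k := by
      ext; simp
    rw [Function.comp_apply, this, Fin.append_right]
  · exact Subsingleton.elim _ _

variable (M : ∀ p q : ℕ, ⨂[K]^p V ⊗[K] ⨂[K]^q V →ₗ[K] V)

/-- The map `M^{⊗(n+2)} ∘ (Δ^{(n)} ⊗ id)`. -/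
def stepMap (n : ℕ) : (TSpace K V ⊗[K] TSpace K V) ⊗[K] (TSpace K V ⊗[K] TSpace K V) →ₗ[K]
    ⨂[K]^(n + 1 + 1) V :=
  (TensorPower.mulEquiv (R := K) (M := V)).toLinearMap ∘ₗ
    TensorProduct.map (powComp s M n) (powOne.symm.toLinearMap ∘ₗ assemble M)

theorem stepMap_tmul (n : ℕ) (a b : TSpace K V ⊗[K] TSpace K V) :
    stepMap s M n (a ⊗ₜ b) = mulTo rfl (powComp s M n a) (powOne.symm (assemble M b)) :=
  (mulTo_rfl _ _).symm

theorem powComp_zero_apply (t : TSpace K V ⊗[K] TSpace K V) :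
    powComp s M 0 t = powOne.symm (assemble M t) := by
  simp only [powComp, iterRedCoprod, LinearMap.comp_apply, LinearEquiv.coe_coe, powOne_symm,
    PiTensorProduct.map_tprod]

/-- The terms subtracted in the reduced coproduct contribute nothing: each has a factor $1_C$, which
both $M$ and its iterates kill. -/
theorem powComp_succ_apply (hM : M 0 0 = 0) (n : ℕ) (t : TSpace K V ⊗[K] TSpace K V) :
    powComp s M (n + 1) t = stepMap s M n (coprod s t) := by
  have h0 : assemble M (unit₂ K V) = 0 := by
    have := assemble_incl M 0 0 (PiTensorProduct.tprod K Fin.elim0)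
      (PiTensorProduct.tprod K Fin.elim0)
    rw [hM, LinearMap.zero_apply] at this
    exact this
  have h : powComp s M (n + 1) t = stepMap s M n (redCoprod s t) := by
    suffices h : PiTensorProduct.map (fun _ : Fin (n + 1 + 1) => assemble M) ∘ₗ
        (TensorPower.mulEquiv (R := K) (M := TSpace K V ⊗[K] TSpace K V)).toLinearMap ∘ₗ
          TensorProduct.map (iterRedCoprod s n) powOne.symm.toLinearMap = stepMap s M n from
      LinearMap.congr_fun h (redCoprod s t)
    refine TensorProduct.ext' fun a b => ?_
    simp only [stepMap, LinearMap.comp_apply, LinearEquiv.coe_coe, TensorProduct.map_tmul]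
    rw [map_mulEquiv, powOne_symm, powOne_symm, PiTensorProduct.map_tprod]
    rfl
  rw [h]
  simp only [redCoprod, LinearMap.add_apply, LinearMap.smul_apply, map_add, map_smul,
    LinearMap.flip_apply, TensorProduct.mk_apply, stepMap_tmul, h0,
    powComp_eq_zero s M hM n 0 (Nat.zero_le _) _ unit₂_mem, map_zero, LinearMap.zero_apply,
    smul_zero, add_zero]

/-- The term of `M^{⊗(n+2)} Δ^{(n+1)}(x ⊗ y)` which belongs to decompositions of `x` and
`y`. -/
def term (n : ℕ) (a₁ a₂ b₁ b₂ : TSpace K V) : ⨂[K]^(n + 1 + 1) V :=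
  stepMap s M n (middle (beta s) ((a₁ ⊗ₜ a₂) ⊗ₜ (b₁ ⊗ₜ b₂)))

/-- The braided middle factor is in general not a pure tensor. The linear map `G` allows evaluation
without decomposing it. -/
theorem middle_tmul {A : Type*} [AddCommMonoid A] [Module K A] {W : Type*} [AddCommMonoid W]
    [Module K W] (g : (A ⊗[K] A) ⊗[K] (A ⊗[K] A) →ₗ[K] W) (f : A ⊗[K] A →ₗ[K] A ⊗[K] A)
    (G : A ⊗[K] A →ₗ[K] W) (a₁ a₂ b₁ b₂ : A)
    (hG : ∀ z y, G (z ⊗ₜ y) = g ((a₁ ⊗ₜ z) ⊗ₜ (y ⊗ₜ b₂))) :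
    g (middle f ((a₁ ⊗ₜ a₂) ⊗ₜ (b₁ ⊗ₜ b₂))) = G (f (a₂ ⊗ₜ b₁)) := by
  simp only [middle, LinearMap.comp_apply, LinearEquiv.coe_coe, TensorProduct.assoc_tmul,
    LinearMap.lTensor_tmul, TensorProduct.assoc_symm_tmul, LinearMap.rTensor_tmul]
  induction f (a₂ ⊗ₜ b₁) with
  | zero => simp
  | add x y hx hy => simp only [map_add, TensorProduct.add_tmul, TensorProduct.tmul_add, hx, hy]
  | tmul z y => rw [hG, TensorProduct.assoc_tmul, TensorProduct.assoc_symm_tmul]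

/-- The linear map `z ⊗ y ↦ M^{⊗(n+1)} Δ^{(n)}(a ⊗ z) ⊗ M(y ⊗ b)`. -/
def termMap (n : ℕ) (a b : TSpace K V) : TSpace K V ⊗[K] TSpace K V →ₗ[K] ⨂[K]^(n + 1 + 1) V :=
  TensorProduct.lift <| (mulTo rfl).compl₁₂ (powComp s M n ∘ₗ TensorProduct.mk K _ _ a)
    (powOne.symm.toLinearMap ∘ₗ assemble M ∘ₗ (TensorProduct.mk K _ _).flip b)

theorem termMap_tmul (n : ℕ) (a b z y : TSpace K V) :
    termMap s M n a b (z ⊗ₜ y) =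
      mulTo rfl (powComp s M n (a ⊗ₜ z)) (powOne.symm (assemble M (y ⊗ₜ b))) := rfl

theorem term_eq (n : ℕ) (a₁ a₂ b₁ b₂ : TSpace K V) :
    term s M n a₁ a₂ b₁ b₂ = termMap s M n a₁ b₂ (beta s (a₂ ⊗ₜ b₁)) :=
  middle_tmul _ _ _ _ _ _ _ fun z y => by rw [termMap_tmul, stepMap_tmul]

/-- The braiding preserves degrees, so the left factor has degree `a₁ + b₁` and the right one `a₂ +
b₂`. The former must exceed `n` and the latter must be positive. -/
theorem term_eq_zero (hM : M 0 0 = 0) {n a₁ a₂ b₁ b₂ : ℕ}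
    (h : a₁ + b₁ ≤ n ∨ a₂ + b₂ = 0) (x₁ : ⨂[K]^a₁ V) (x₂ : ⨂[K]^a₂ V)
    (y₁ : ⨂[K]^b₁ V) (y₂ : ⨂[K]^b₂ V) :
    term s M n (incl a₁ x₁) (incl a₂ x₂) (incl b₁ y₁) (incl b₂ y₂) = 0 := by
  rw [term_eq, beta, assemble_incl, LinearMap.comp_apply]
  induction betaHom s a₂ b₁ (x₂ ⊗ₜ y₁) with
  | zero => simp
  | add x y hx hy => simp only [map_add, hx, hy, add_zero]
  | tmul z y =>
    rw [TensorProduct.map_tmul, termMap_tmul]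
    rcases h with h | h
    · rw [powComp_eq_zero s M hM n _ h _ (Submodule.subset_span ⟨_, _, _, _, rfl, rfl⟩),
        map_zero, LinearMap.zero_apply]
    · obtain ⟨rfl, rfl⟩ : a₂ = 0 ∧ b₂ = 0 := by omega
      rw [assemble_incl, hM, LinearMap.zero_apply, map_zero, map_zero]

/-- The term of `M^{⊗(n+2)} Δ^{(n+1)}` on a product of pure tensors which belongs to cutting them
after `k` and `l` letters. -/
def cutTerm (n : ℕ) {i j : ℕ} (v : Fin i → V) (w : Fin j → V) (k : Fin (i + 1))
    (l : Fin (j + 1)) : ⨂[K]^(n + 1 + 1) V :=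
  term s M n
    (incl k (PiTensorProduct.tprod K fun m : Fin k => v ⟨m, by omega⟩))
    (incl (i - k) (PiTensorProduct.tprod K fun m : Fin (i - k) => v ⟨k + m, by omega⟩))
    (incl l (PiTensorProduct.tprod K fun m : Fin l => w ⟨m, by omega⟩))
    (incl (j - l) (PiTensorProduct.tprod K fun m : Fin (j - l) => w ⟨l + m, by omega⟩))

theorem cutTerm_eq_zero (hM : M 0 0 = 0) {n i j : ℕ} (v : Fin i → V) (w : Fin j → V)
    (k : Fin (i + 1)) (l : Fin (j + 1)) (h : (k : ℕ) + l ≤ n ∨ i + j ≤ (k : ℕ) + l) :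
    cutTerm s M n v w k l = 0 :=
  term_eq_zero s M hM (by omega) _ _ _ _

theorem powComp_succ_tprod (hM : M 0 0 = 0) (n : ℕ) {i j : ℕ} (v : Fin i → V) (w : Fin j → V) :
    powComp s M (n + 1)
        (incl i (PiTensorProduct.tprod K v) ⊗ₜ incl j (PiTensorProduct.tprod K w)) =
      ∑ k : Fin (i + 1), ∑ l : Fin (j + 1), cutTerm s M n v w k l := by
  rw [powComp_succ_apply s M hM, coprod, LinearMap.comp_apply, TensorProduct.map_tmul,
    deconc_incl_tprod, deconc_incl_tprod]
  simp only [TensorProduct.sum_tmul, TensorProduct.tmul_sum, map_sum]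
  exact Finset.sum_comm

end Recursion

/-! ### Sums with only the extreme cuts surviving -/

section Sums

variable {X : Type*} [AddCommMonoid X]

/-- The support lies on the line $k+l=i+j+1$, which meets the rectangle $k\le i+1$, $l\le j+1$ only
in two points next to the far corner. -/
theorem sum_fin_succ_succ {i j : ℕ} (G : Fin (i + 1 + 1) → Fin (j + 1 + 1) → X)
    (hG : ∀ (k : Fin (i + 1 + 1)) (l : Fin (j + 1 + 1)), ((k : ℕ) + l < i + j + 1 ∨ i + j + 2 ≤ (k : ℕ) + l) → G k l = 0) :
    ∑ k, ∑ l, G k l =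
      G (Fin.last _) (Fin.last _).castSucc + G (Fin.last _).castSucc (Fin.last _) := by
  have hk : ∀ k : Fin i, ∑ l, G k.castSucc.castSucc l = 0 := fun k =>
    Finset.sum_eq_zero fun l _ => hG _ _ (by simp only [Fin.val_castSucc]; omega)
  rw [Fin.sum_univ_castSucc, Fin.sum_univ_castSucc, Finset.sum_eq_zero fun k _ => hk k, zero_add,
    add_comm]
  congr 1
  · refine Finset.sum_eq_single _ (fun l _ hl => hG _ _ ?_) (by simp)
    simp only [ne_eq, Fin.ext_iff, Fin.val_castSucc, Fin.val_last] at hl ⊢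
    omega
  · refine Finset.sum_eq_single _ (fun l _ hl => hG _ _ ?_) (by simp)
    simp only [ne_eq, Fin.ext_iff, Fin.val_castSucc, Fin.val_last] at hl ⊢
    omega

theorem sum_fin_succ {i : ℕ} (G : Fin (i + 1 + 1) → X)
    (hG : ∀ k : Fin (i + 1 + 1), ((k : ℕ) < i ∨ i + 1 ≤ (k : ℕ)) → G k = 0) :
    ∑ k, G k = G (Fin.last _).castSucc := by
  refine Finset.sum_eq_single _ (fun l _ hl => hG _ ?_) (by simp)
  simp only [ne_eq, Fin.ext_iff, Fin.val_castSucc, Fin.val_last] at hl ⊢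
  omega

end Sums

/-! ### The top-degree component -/

section Main

variable {K V : Type*} [Field K] [AddCommGroup V] [Module K V] (A : QuantumBInftyAlgebra K V)

theorem powOne_symm_M_one_zero (y : ⨂[K]^1 V) (u : Fin 0 → V) :
    powOne.symm (assemble A.M (incl 1 y ⊗ₜ incl 0 (PiTensorProduct.tprod K u))) = y := by
  obtain ⟨v, rfl⟩ := powOne.symm.surjective y
  rw [assemble_incl, Subsingleton.elim u Fin.elim0, A.M_one_zero]

theorem powOne_symm_M_zero_one (y : ⨂[K]^1 V) (u : Fin 0 → V) :
    powOne.symm (assemble A.M (incl 0 (PiTensorProduct.tprod K u) ⊗ₜ incl 1 y)) = y := by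
  obtain ⟨v, rfl⟩ := powOne.symm.surjective y
  rw [assemble_incl, Subsingleton.elim u Fin.elim0, A.M_zero_one]

theorem term_right (n : ℕ) {j : ℕ} (a : TSpace K V) (u : Fin 0 → V) (w : Fin j → V)
    (y : ⨂[K]^1 V) :
    term A.sigma.toLinearMap A.M n a (incl 0 (PiTensorProduct.tprod K u))
        (incl j (PiTensorProduct.tprod K w)) (incl 1 y) =
      mulTo rfl (powComp A.sigma.toLinearMap A.M n (a ⊗ₜ incl j (PiTensorProduct.tprod K w)))
        y := by
  rw [term_eq, beta, assemble_incl, LinearMap.comp_apply, betaHom_zero _ A.yang_baxter,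
    TensorProduct.map_tmul, termMap_tmul, powOne_symm_M_zero_one]

/-- The letter `a` crosses `b` by $\beta_{1j}=T_{\chi_{1j}}$, and $\chi_{1j}$ is the cycle moving
the first of `1 + j` letters to the end. On the whole word this is the cycle at position `i`. The
induction hypothesis is needed for every `y`, because the braiding replaces `b` by other tensors of
degree `j`. -/
theorem term_left {n i j : ℕ} (h : i + (1 + j) = n + 1 + 1) (x : ⨂[K]^i V) (a : ⨂[K]^1 V)
    (b : ⨂[K]^j V) (u : Fin 0 → V)
    (ih : ∀ (hij : i + j = n + 1) (y : ⨂[K]^j V),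
      powComp A.sigma.toLinearMap A.M n (incl i x ⊗ₜ incl j y) =
        shufSum A.sigma.toLinearMap (n + 1) i (mulTo hij x y)) :
    term A.sigma.toLinearMap A.M n (incl i x) (incl 1 a) (incl j b)
        (incl 0 (PiTensorProduct.tprod K u)) =
      cycSum A.sigma.toLinearMap (n + 1) i (mulTo h x (mulTo rfl a b)) := by
  have hij : i + j = n + 1 := by omega
  have h' : i + (j + 1) = n + 1 + 1 := by omega
  -- Stated for arbitrary `t`, so that linearity reduces the output of the braiding to pure tensors.
  have key : ∀ t : ⨂[K]^j V ⊗[K] ⨂[K]^1 V,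
      termMap A.sigma.toLinearMap A.M n (incl i x) (incl 0 (PiTensorProduct.tprod K u))
        (TensorProduct.map (incl j) (incl 1) t) =
      (∑ w ∈ shuf (n + 1) i, braidLift A.sigma.toLinearMap (emb w))
        (mulTo h' x (TensorPower.mulEquiv (R := K) (M := V) t)) := by
    intro t
    induction t with
    | zero => simp
    | add t t' ht ht' => simp only [map_add, ht, ht']
    | tmul z y =>
      rw [TensorProduct.map_tmul, termMap_tmul, powOne_symm_M_one_zero, ih hij,
        ← sum_emb_mulTo _ A.yang_baxter, ← mulTo_rfl, mulTo_assoc]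
  rw [term_eq, beta, assemble_incl, LinearMap.comp_apply, key, cycSum, Module.End.mul_apply]
  have hc := braidLift_cyc_mulTo _ A.yang_baxter h 0 x (mulTo rfl a b)
  rw [add_zero] at hc
  rw [hc]
  simp only [betaHom, LinearMap.comp_apply, LinearEquiv.coe_coe, LinearEquiv.apply_symm_apply,
    chi_one, mulTo_cast, mulTo_rfl]

theorem mulTo_split_last {i n : ℕ} (h : i + 1 = n) (v : Fin n → V) :
    mulTo h (PiTensorProduct.tprod K fun k : Fin i => v ⟨k, by omega⟩)
      (PiTensorProduct.tprod K fun _ : Fin 1 => v ⟨i, by omega⟩) = PiTensorProduct.tprod K v := by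
  rw [← mulTo_eq_tprod h v]
  congr 2
  funext k
  congr 1
  ext
  simp

theorem cutTerm_right (n : ℕ) {i j : ℕ} (v : Fin i → V) (w : Fin (j + 1) → V) (k : Fin (i + 1))
    (l : Fin (j + 1 + 1)) (hk : (k : ℕ) = i) (hl : (l : ℕ) = j) :
    cutTerm A.sigma.toLinearMap A.M n v w k l =
      mulTo rfl (powComp A.sigma.toLinearMap A.M n (incl i (PiTensorProduct.tprod K v) ⊗ₜ
        incl j (PiTensorProduct.tprod K fun m : Fin j => w ⟨m, by omega⟩)))
        (PiTensorProduct.tprod K fun _ : Fin 1 => w ⟨j, by omega⟩) := by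
  obtain ⟨k, hk'⟩ := k
  obtain ⟨l, hl'⟩ := l
  obtain rfl : k = i := hk
  obtain rfl : l = j := hl
  rw [← term_right A n _ Fin.elim0, cutTerm]
  congr 1
  · exact incl_tprod_congr (Nat.sub_self k) _ _ fun m => absurd m.2 (by simp)
  · refine incl_tprod_congr (Nat.add_sub_cancel_left _ _) _ _ fun m => ?_
    have := m.2
    refine congrArg w (Fin.ext ?_)
    simp only at this ⊢
    omega

theorem cutTerm_left {n i j : ℕ} (h : i + 1 + j = n + 1 + 1) (v : Fin (i + 1) → V)
    (w : Fin j → V) (k : Fin (i + 1 + 1)) (l : Fin (j + 1)) (hk : (k : ℕ) = i) (hl : (l : ℕ) = j)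
    (ih : ∀ (hij : i + j = n + 1) (x : ⨂[K]^i V) (y : ⨂[K]^j V),
      powComp A.sigma.toLinearMap A.M n (incl i x ⊗ₜ incl j y) =
        shufSum A.sigma.toLinearMap (n + 1) i (mulTo hij x y)) :
    cutTerm A.sigma.toLinearMap A.M n v w k l =
      cycSum A.sigma.toLinearMap (n + 1) i
        (mulTo h (PiTensorProduct.tprod K v) (PiTensorProduct.tprod K w)) := by
  obtain ⟨k, hk'⟩ := k
  obtain ⟨l, hl'⟩ := l
  obtain rfl : k = i := hk
  obtain rfl : l = j := hl
  rw [← mulTo_split_last rfl v, mulTo_assoc rfl h rfl (by omega),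
    ← term_left A _ _ _ _ Fin.elim0 (fun hij y => ih hij _ y), cutTerm]
  congr 1
  · refine incl_tprod_congr (Nat.add_sub_cancel_left _ _) _ _ fun m => ?_
    have := m.2
    refine congrArg v (Fin.ext ?_)
    simp only at this ⊢
    omega
  · exact incl_tprod_congr (Nat.sub_self l) _ _ fun m => absurd m.2 (by simp)

theorem powComp_incl (n : ℕ) {i j : ℕ} (h : i + j = n + 1) (x : ⨂[K]^i V) (y : ⨂[K]^j V) :
    powComp A.sigma.toLinearMap A.M n (incl i x ⊗ₜ incl j y) =
      shufSum A.sigma.toLinearMap (n + 1) i (mulTo h x y) := by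
  induction n generalizing i j with
  | zero =>
    rw [powComp_zero_apply, shufSum_one _ A.yang_baxter, Module.End.one_apply]
    suffices H : ∀ (v : Fin i → V) (w : Fin j → V), powOne.symm (assemble A.M
        (incl i (PiTensorProduct.tprod K v) ⊗ₜ incl j (PiTensorProduct.tprod K w))) =
        mulTo h (PiTensorProduct.tprod K v) (PiTensorProduct.tprod K w) by
      have : ((TensorProduct.mk K _ _).compl₁₂ (incl i) (incl j)).compr₂
          (powOne.symm.toLinearMap ∘ₗ assemble A.M) = mulTo h := ext_tprod₂ H
      exact LinearMap.congr_fun₂ this x y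
    intro v w
    obtain ⟨rfl, rfl⟩ | ⟨rfl, rfl⟩ : i = 1 ∧ j = 0 ∨ i = 0 ∧ j = 1 := by omega
    · rw [powOne_symm_M_one_zero, mulTo_tprod]
      congr 1
      funext k
      exact (Fin.append_left v w k).symm
    · rw [powOne_symm_M_zero_one, mulTo_tprod]
      congr 1
      funext k
      rw [← Fin.append_right v w k]
      congr 1
      ext
      simp
  | succ n ih =>
    suffices H : ∀ (v : Fin i → V) (w : Fin j → V),
        powComp A.sigma.toLinearMap A.M (n + 1)
          (incl i (PiTensorProduct.tprod K v) ⊗ₜ incl j (PiTensorProduct.tprod K w)) =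
        shufSum A.sigma.toLinearMap (n + 1 + 1) i
          (mulTo h (PiTensorProduct.tprod K v) (PiTensorProduct.tprod K w)) by
      have : ((TensorProduct.mk K _ _).compl₁₂ (incl i) (incl j)).compr₂
          (powComp A.sigma.toLinearMap A.M (n + 1)) =
          (mulTo h).compr₂ (shufSum A.sigma.toLinearMap (n + 1 + 1) i) := ext_tprod₂ H
      exact LinearMap.congr_fun₂ this x y
    intro v w
    have right : ∀ (j' : ℕ) (hj : j = j' + 1) (k : Fin (i + 1)) (l : Fin (j + 1)),
        (k : ℕ) = i → (l : ℕ) = j' → cutTerm A.sigma.toLinearMap A.M n v w k l =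
          (∑ u ∈ shuf (n + 1) i, braidLift A.sigma.toLinearMap (emb u))
            (mulTo h (PiTensorProduct.tprod K v) (PiTensorProduct.tprod K w)) := by
      rintro j' rfl k l hk hl
      rw [cutTerm_right A n v w k l hk hl, ih (by omega), ← sum_emb_mulTo _ A.yang_baxter,
        mulTo_assoc _ rfl rfl h, mulTo_split_last]
    rw [powComp_succ_tprod _ _ A.M_zero_zero]
    -- If one of the two words is empty, one of the two surviving cuts is missing, as is the
    -- corresponding class of shuffles.
    rcases i with _ | i
    · obtain rfl : j = n + 1 + 1 := by omega
      rw [Fin.sum_univ_one, sum_fin_succ _ fun l hl => cutTerm_eq_zero _ _ A.M_zero_zero _ _ _ _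
        (by simp only [Fin.val_zero]; omega), right _ rfl _ _ rfl rfl, shufSum_succ_zero]
    rcases j with _ | j
    · obtain rfl : i = n + 1 := by omega
      rw [Finset.sum_congr rfl fun k _ => Fin.sum_univ_one _, sum_fin_succ _ fun l hl => cutTerm_eq_zero _ _ A.M_zero_zero _ _ _ _
        (by simp only [Fin.val_zero]; omega), cutTerm_left A h _ _ _ _ rfl rfl fun hij => ih hij,
        shufSum_succ_self _ A.yang_baxter]
    · rw [sum_fin_succ_succ _ fun k l hl => cutTerm_eq_zero _ _ A.M_zero_zero _ _ _ _
        (by omega), right _ rfl _ _ rfl rfl, cutTerm_left A h _ _ _ _ rfl rfl fun hij => ih hij,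
        shufSum_succ_succ _ A.yang_baxter (by omega), LinearMap.add_apply]

/-! ### Homogeneous components of the product -/

theorem proj_incl (n : ℕ) (x : ⨂[K]^n V) : proj n (incl n x) = x := by
  simp only [proj, incl, DirectSum.component.lof_self]

theorem proj_incl_of_ne {m n : ℕ} (h : m ≠ n) (x : ⨂[K]^m V) : proj n (incl m x) = 0 := by
  simp only [proj, incl, DirectSum.component.of, dif_neg h]

theorem proj_starTerm_of_ne {m n : ℕ} (h : m ≠ n) (t : TSpace K V ⊗[K] TSpace K V) :
    proj n (starTerm A m t) = 0 := by
  cases m with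
  | zero =>
    have h1 : (1 : TSpace K V) = incl 0 (PiTensorProduct.tprod K Fin.elim0) := rfl
    rw [starTerm, LinearMap.comp_apply, LinearMap.toSpanSingleton_apply, map_smul, h1,
      proj_incl_of_ne h, smul_zero]
  | succ m => rw [starTerm, LinearMap.comp_apply, proj_incl_of_ne h]

/-- Different summands of $\ast$ take values in different degrees, so each component comes from a
single summand. -/
theorem proj_starProd (n : ℕ) (t : TSpace K V ⊗[K] TSpace K V) :
    proj n (starProd A t) = proj n (starTerm A n t) := by
  change proj n (∑ᶠ m, starTerm A m t) = _
  rw [map_finsum _ (starTerm_finite A t)]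
  exact finsum_eq_single _ n fun m hm => proj_starTerm_of_ne A hm t

theorem incl_mem_homog {i j : ℕ} (x : ⨂[K]^i V) (y : ⨂[K]^j V) :
    incl i x ⊗ₜ incl j y ∈ homog K V (i + j) :=
  Submodule.subset_span ⟨i, j, x, y, rfl, rfl⟩

theorem quantumShuffle_incl {n i j : ℕ} (h : i + j = n) (s : V ⊗[K] V →ₗ[K] V ⊗[K] V)
    (x : ⨂[K]^i V) (y : ⨂[K]^j V) :
    quantumShuffle s (incl i x ⊗ₜ incl j y) = incl n (shufSum s n i (mulTo h x y)) := by
  subst h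
  rw [quantumShuffle, assemble_incl, LinearMap.comp_apply, shuffleHom, shuffles_eq_shuf,
    mulTo_rfl]
  rfl

theorem starTerm_zero_incl (x y : ⨂[K]^0 V) :
    starTerm A 0 (incl 0 x ⊗ₜ incl 0 y) = quantumShuffle A.sigma.toLinearMap
      (incl 0 x ⊗ₜ incl 0 y) := by
  rw [quantumShuffle_incl rfl, shufSum_zero _ A.yang_baxter, Module.End.one_apply]
  suffices H : ∀ v w : Fin 0 → V,
      starTerm A 0 (incl 0 (PiTensorProduct.tprod K v) ⊗ₜ incl 0 (PiTensorProduct.tprod K w)) =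
        incl 0 (mulTo rfl (PiTensorProduct.tprod K v) (PiTensorProduct.tprod K w)) by
    have : ((TensorProduct.mk K _ _).compl₁₂ (incl 0) (incl 0)).compr₂ (starTerm A 0) =
        (mulTo rfl).compr₂ (incl 0) := ext_tprod₂ H
    exact LinearMap.congr_fun₂ this x y
  intro v w
  have h1 : (1 : TSpace K V) = incl 0 (PiTensorProduct.tprod K Fin.elim0) := rfl
  have h2 : ∀ u : Fin 0 → V, counit (incl 0 (PiTensorProduct.tprod K u)) = (1 : K) := fun u => by
    rw [counit, LinearMap.comp_apply, proj_incl]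
    exact PiTensorProduct.isEmptyEquiv_apply_tprod _ _
  simp only [starTerm, LinearMap.comp_apply, TensorProduct.map_tmul, h2, LinearEquiv.coe_coe,
    TensorProduct.lid_tmul, LinearMap.toSpanSingleton_apply, smul_eq_mul, mul_one, one_smul, h1,
    mulTo_tprod]
  congr 2
  exact Subsingleton.elim _ _

theorem restrict_powComp {i j n : ℕ} (h : i + j = n + 1) :
    restrict (powComp A.sigma.toLinearMap A.M n) i j =
      (TensorPower.cast K V h).toLinearMap ∘ₗ
        (∑ w ∈ shuffles i j, braidLift A.sigma.toLinearMap w) ∘ₗ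
          (TensorPower.mulEquiv (R := K) (M := V)).toLinearMap := by
  refine TensorProduct.ext' fun x y => ?_
  rw [restrict, LinearMap.comp_apply, TensorProduct.map_tmul, powComp_incl A n h,
    shuffles_eq_shuf]
  simp only [LinearMap.comp_apply, LinearEquiv.coe_coe, ← mulTo_rfl]
  -- With the total degree as a variable, the equation can be eliminated and the cast becomes the
  -- identity.
  have aux : ∀ (m : ℕ) (h : i + j = m), shufSum A.sigma.toLinearMap m i (mulTo h x y) =
      TensorPower.cast K V h
        ((∑ w ∈ shuf (i + j) i, braidLift A.sigma.toLinearMap w) (mulTo rfl x y)) := by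
    rintro _ rfl
    rw [TensorPower.cast_refl]
    rfl
  exact aux _ h

end Main

end QuantumBInfty

open QuantumBInfty in
theorem proposition4p21 {K V : Type*} [Field K] [CharZero K] [AddCommGroup V] [Module K V]
    (A : QuantumBInftyAlgebra K V) :
    (∀ (i j : ℕ) (x : ⨂[K]^i V) (y : ⨂[K]^j V),
      (∀ n : ℕ, i + j < n → proj n (starProd A (incl i x ⊗ₜ[K] incl j y)) = 0) ∧
      incl (i + j) (proj (i + j) (starProd A (incl i x ⊗ₜ[K] incl j y))) =
        quantumShuffle A.sigma.toLinearMap (incl i x ⊗ₜ[K] incl j y)) ∧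
    (∀ (i j n : ℕ) (h : i + j = n + 1),
      restrict (powComp A.sigma.toLinearMap A.M n) i j =
        (TensorPower.cast K V h).toLinearMap ∘ₗ
          (∑ w ∈ shuffles i j, braidLift A.sigma.toLinearMap w) ∘ₗ
            (TensorPower.mulEquiv (R := K) (M := V)).toLinearMap) := by
  refine ⟨fun i j x y => ⟨fun n hn => ?_, ?_⟩, fun i j n h => restrict_powComp A h⟩
  · obtain ⟨n, rfl⟩ : ∃ m, n = m + 1 := ⟨n - 1, by omega⟩
    rw [proj_starProd, starTerm, LinearMap.comp_apply, proj_incl,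
      powComp_eq_zero _ _ A.M_zero_zero n _ (by omega) _ (incl_mem_homog x y)]
  · rw [proj_starProd]
    -- In degree $0$ the relevant summand is $\varepsilon\otimes\varepsilon$, and in degree $n+1$ it
    -- is $M^{\otimes(n+1)}\circ\overline\Delta_\beta^{(n)}$.
    generalize hn : i + j = n
    cases n with
    | zero =>
      obtain ⟨rfl, rfl⟩ : i = 0 ∧ j = 0 := by omega
      rw [starTerm_zero_incl, quantumShuffle_incl rfl, proj_incl]
    | succ n =>
      rw [starTerm, LinearMap.comp_apply, proj_incl, powComp_incl A n hn, quantumShuffle_incl hn]
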